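/- **Definitions.** A *clause* is a finite set of propositional literals containing at most one literal on each variable. A *QCBF instance* $\psi$ is a formula without free variables built from clauses, conjunctions of arbitrary finite arity, and the quantifiers $\forall v$, $\exists v$; a clause counts as a leaf of the formula tree. Its *locations* are the nodes of its formula tree, $\psi(i)$ is the subformula at location $i$, and $\mathrm{free}(\psi(i))$ is its set of free variables. *Proofs.* A *clause judgement* is a pair $(i,\alpha)$ of a location and a clause with $\mathrm{vars}(\alpha)\subseteq\mathrm{free}(\psi(i))$. A *clause judgement proof* is a finite sequence of clause judgements, each derived by one of these rules: - (clause) $(i,\alpha)$, if $\psi(i)$ is the clause $\alpha$; - (resolve) $(i,\gamma)$ from $(i,\alpha)$ and $(i,\beta)$, if $\gamma=(\alpha\setminus\{L\})\cup(\beta\setminus\{\overline L\})$ for some literal $L\in\alpha$ with $\overline L\in\beta$; - (upward flow) $(i,\alpha)$ from $(j,\alpha)$, if $i$ is the parent of $j$; - ($\forall$-removal) $(i,\alpha\setminus\{y,\overline y\})$ from $(j,\alpha)$, if $i$ is the parent of $j$ and $\psi(i)=\forall y\,\psi(j)$; - (downward flow) $(j,\alpha)$ from $(i,\alpha)$, if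 $i$ is the parent of $j$. The judgements used in these rules must occur earlier in the sequence. The proof is *tree-like* if each judgement is used to derive at most one other; each judgement then induces a tree, in which the children of a judgement are those it was derived from. A judgement is a *flow* judgement if its derivation from its predecessor is an instance of (upward flow) or (downward flow); this includes the instances of ($\forall$-removal) in which $\alpha$ has no literal on $y$. The other judgements are *non-flow* judgements. *Traces.* A *located variable* is a pair $(i,u)$ such that $u$ is quantified at location $i$; it is *$\forall$-located* if it is universally quantified there. A location $j$ *follows* $(i,u)$ if $i$ is a proper ancestor of $j$ and $u\in\mathrm{free}(\psi(k))$ for all locations $k\ne i$ on the path from $i$ to $j$, including $j$; and $(j,v)$ follows $(i,u)$ if $j$ does. Following a set means following each of its elements. A set $S$ of located variables is *coherent* if of any two distinct elements one follows the other, and $\mathrm{vars}(S)$ is the set of its variables. A *trace* of $\psi$ (a recursion tree of the nondeterministic algorithm Detect_Falsity) is a finite rooted tree in which every node has a label $(S,a)$, with $S$ coherent and $a:\mathrm{vars}(S)\to\{0,1\}$, and in which each node is of one of these kinds: - (falsify) it has no children, and an associated location $i$ that follows $S$ such that $\psi(i)$ is a clause falsified by $a$ with $\mathrm{vars}(\psi(i))=\mathrm{vars}(S)$;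 - ($\forall$-branch) it has one child, whose label is $(S\cup\{(i,y)\},a[y\to b])$ for some $\forall$-located variable $(i,y)$ that follows $S$ and some $b\in\{0,1\}$; - (Q-branch) it has two children, with labels $(S_b\cup\{(i,u)\},(a\upharpoonright\mathrm{vars}(S_b))[u\to b])$ for $b=0,1$, where $(i,u)\notin S$ is a located variable with $S\cup\{(i,u)\}$ coherent and $S_0\cup S_1=S$. Let $e$ be the assignment with empty domain. **Theorem.** Let $\psi$ be a QCBF instance and let $n\ge 1$. There is a tree-like clause judgement proof, viewed as a tree, of an empty clause (that is, with root $(i,\emptyset)$ for some location $i$) with exactly $n$ non-flow judgements if and only if there is a trace of $\psi$ with root label $(\emptyset,e)$ and exactly $n$ nodes. Moreover, both translations are computable in polynomial time: there is a polynomial-time algorithm that, given a QCBF instance $\psi$ and such a proof tree, produces a trace of $\psi$ with root label $(\emptyset,e)$ whose number of nodes is the number of non-flow judgements of the proof tree; and there is a polynomial-time algorithm that, given $\psi$ and a trace of $\psi$ with root label $(\emptyset,e)$, produces such a proof tree whose number of non-flow judgements is the number of nodes of the trace. -/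

import Mathlib

namespace QCBFTrace

/-! ### Clauses and QCBF formulas -/

/-- Propositional variables. -/
abbrev Var := ℕ

/-- A literal: `(v, true)` is the literal `v`, and `(v, false)` is its negation. -/
abbrev Literal := Var × Bool

/-- The complement of a literal. -/
def Literal.compl (L : Literal) : Literal := (L.1, !L.2)

/-- A clause: a finite set of literals with at most one literal on each variable. -/
@[ext]
structure Clause where
  lits : Finset Literal
  nontaut : ∀ v : Var, ¬ ((v, true) ∈ lits ∧ (v, false) ∈ lits)

/-- The variables of a clause. -/
def Clause.vars (C : Clause) : Finset Var := C.lits.image Prod.fst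

/-- `γ` is a resolvent of `α` and `β`. -/
def IsResolvent (γ α β : Clause) : Prop :=
  ∃ L ∈ α.lits, L.compl ∈ β.lits ∧ γ.lits = α.lits.erase L ∪ β.lits.erase L.compl

/-- Formulas built from clauses, conjunctions of arbitrary finite arity, and quantifiers. -/
inductive QCBF : Type
  | clause (C : Clause) : QCBF
  | conj (n : ℕ) (φ : Fin n → QCBF) : QCBF
  | all (v : Var) (φ : QCBF) : QCBF
  | ex (v : Var) (φ : QCBF) : QCBF

/-- Free variables. -/
def QCBF.free : QCBF → Finset Var
  | .clause C => C.vars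
  | .conj _ φ => Finset.univ.biUnion fun k => (φ k).free
  | .all v φ => φ.free.erase v
  | .ex v φ => φ.free.erase v

/-- A QCBF instance is a formula without free variables. -/
def QCBF.IsInstance (ψ : QCBF) : Prop := ψ.free = ∅

/-- Locations in a formula tree: the path from the root, as the list of the numbers of the
children taken. -/
abbrev Loc := List ℕ

/-- The subformula `ψ(i)` at a location, if the location exists in `ψ`; the index set of `ψ`
consists of the locations `i` for which `ψ.at? i` is not `none`. -/
def QCBF.at? : QCBF → Loc → Option QCBF
  | φ, [] => some φ
  | .clause _, _ :: _ => none
  | .conj n φ, k :: i => if h : k < n then (φ ⟨k, h⟩).at? i else none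
  | .all _ φ, k :: i => if k = 0 then φ.at? i else none
  | .ex _ φ, k :: i => if k = 0 then φ.at? i else none

/-- `i` is the parent of `j`. -/
def IsParent (i j : Loc) : Prop := ∃ k, j = i ++ [k]

/-- The variable `v` is free in the subformula at location `i`. -/
def FreeAt (ψ : QCBF) (i : Loc) (v : Var) : Prop := ∃ φ, ψ.at? i = some φ ∧ v ∈ φ.free

/-! ### Clause judgement proofs -/

/-- A pair of a location and a clause. -/
structure Judgement where
  loc : Loc
  clause : Clause

/-- `J` is a clause judgement on `ψ`: its location exists in `ψ`, and the variables of its clause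
are free there. -/
def IsJudgement (ψ : QCBF) (J : Judgement) : Prop :=
  ∃ φ, ψ.at? J.loc = some φ ∧ J.clause.vars ⊆ φ.free

/-- `(up)` and `(down)`: `J` arises from `A` by an upward or a downward flow step. -/
def IsFlowStep (A J : Judgement) : Prop :=
  J.clause = A.clause ∧ (IsParent J.loc A.loc ∨ IsParent A.loc J.loc)

/-- `Derives ψ As J`: the judgement `J` is obtained by one of the proof rules from the list `As`
of its predecessors. -/
inductive Derives (ψ : QCBF) : List Judgement → Judgement → Prop
  | clause {i : Loc} {α : Clause} (h : ψ.at? i = some (.clause α)) : Derives ψ [] ⟨i, α⟩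
  | resolve {i : Loc} {α β γ : Clause} (h : IsResolvent γ α β) :
      Derives ψ [⟨i, α⟩, ⟨i, β⟩] ⟨i, γ⟩
  | upwardFlow {i j : Loc} {α : Clause} (h : IsParent i j) : Derives ψ [⟨j, α⟩] ⟨i, α⟩
  | allRemoval {i j : Loc} {α γ : Clause} {y : Var} {φ : QCBF}
      (hi : ψ.at? i = some (.all y φ)) (h : IsParent i j)
      (hγ : γ.lits = α.lits \ {(y, true), (y, false)}) : Derives ψ [⟨j, α⟩] ⟨i, γ⟩
  | downwardFlow {i j : Loc} {α : Clause} (h : IsParent i j) : Derives ψ [⟨i, α⟩] ⟨j, α⟩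

/-- A line of a proof: a judgement, with the positions of the lines it is derived from. -/
structure ProofLine where
  judgement : Judgement
  premises : List ℕ

/-- A clause judgement proof on `ψ`: a finite sequence of clause judgements, each derived by a
rule from earlier ones. -/
def IsClauseProof (ψ : QCBF) (P : List ProofLine) : Prop :=
  ∀ (t : ℕ) (l : ProofLine), P[t]? = some l →
    IsJudgement ψ l.judgement ∧ (∀ p ∈ l.premises, p < t) ∧
      Derives ψ (l.premises.filterMap fun p => P[p]?.map ProofLine.judgement) l.judgement

/-- Every line has at most one successor. -/
def IsTreeLike (P : List ProofLine) : Prop := (P.flatMap ProofLine.premises).Nodup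

/-- Rooted trees labelled by clause judgements, in which a node has at most two children. -/
inductive ProofTree : Type
  | leaf (J : Judgement) : ProofTree
  | one (J : Judgement) (T : ProofTree) : ProofTree
  | two (J : Judgement) (T₀ T₁ : ProofTree) : ProofTree

/-- The root label. -/
def ProofTree.root : ProofTree → Judgement
  | .leaf J => J
  | .one J _ => J
  | .two J _ _ => J

/-- `Induces P t T`: the line at position `t` of `P` induces the tree `T`. -/
inductive Induces (P : List ProofLine) : ℕ → ProofTree → Prop
  | leaf {t : ℕ} {J : Judgement} (h : P[t]? = some ⟨J, []⟩) : Induces P t (.leaf J)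
  | one {t p : ℕ} {J : Judgement} {T : ProofTree} (h : P[t]? = some ⟨J, [p]⟩)
      (hT : Induces P p T) : Induces P t (.one J T)
  | two {t p q : ℕ} {J : Judgement} {T₀ T₁ : ProofTree} (h : P[t]? = some ⟨J, [p, q]⟩)
      (h₀ : Induces P p T₀) (h₁ : Induces P q T₁) : Induces P t (.two J T₀ T₁)

open Classical in
/-- The number of non-flow judgements: the nodes that do not arise from their predecessor by a
flow step. -/
noncomputable def ProofTree.nonFlow : ProofTree → ℕ
  | .leaf _ => 1
  | .one J T => T.nonFlow + if IsFlowStep T.root J then 0 else 1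
  | .two _ T₀ T₁ => T₀.nonFlow + T₁.nonFlow + 1

/-- `T` is a tree-like clause judgement proof on `ψ`, viewed as a tree, of an empty clause. -/
def IsTreeRefutation (ψ : QCBF) (T : ProofTree) : Prop :=
  (∃ (P : List ProofLine) (t : ℕ), IsClauseProof ψ P ∧ IsTreeLike P ∧ Induces P t T) ∧
    T.root.clause.lits = ∅

/-! ### Located variables and traces -/

/-- A pair of a location and a variable. -/
abbrev LocVar := Loc × Var

/-- The variable is universally quantified at the location. -/
def IsAllLocated (ψ : QCBF) (x : LocVar) : Prop := ∃ φ, ψ.at? x.1 = some (.all x.2 φ)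

/-- The variable is quantified at the location. -/
def IsLocated (ψ : QCBF) (x : LocVar) : Prop :=
  IsAllLocated ψ x ∨ ∃ φ, ψ.at? x.1 = some (.ex x.2 φ)

/-- The location `j` follows the located variable `x`: it lies strictly below the location of `x`,
and the variable is free at all locations strictly below that one, down to `j`. -/
def Follows (ψ : QCBF) (j : Loc) (x : LocVar) : Prop :=
  x.1 <+: j ∧ x.1 ≠ j ∧ ∀ k : Loc, x.1 <+: k → x.1 ≠ k → k <+: j → FreeAt ψ k x.2

/-- The location `j` follows all elements of `S`. -/
def FollowsSet (ψ : QCBF) (j : Loc) (S : Finset LocVar) : Prop := ∀ x ∈ S, Follows ψ j x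

/-- Coherent sets of located variables. -/
def IsCoherent (ψ : QCBF) (S : Finset LocVar) : Prop :=
  (∀ x ∈ S, IsLocated ψ x) ∧
    ∀ x ∈ S, ∀ y ∈ S, x ≠ y → Follows ψ x.1 y ∨ Follows ψ y.1 x

/-- The variables of a set of located variables. -/
def varsOf (S : Finset LocVar) : Finset Var := S.image Prod.snd

/-- Partial assignments to the variables; `none` means undefined. -/
abbrev Assignment := Var → Option Bool

/-- The restriction of an assignment. -/
def Assignment.restrict (a : Assignment) (V : Finset Var) : Assignment :=
  fun v => if v ∈ V then a v else none

/-- The assignment `a[u → b]`. -/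
def Assignment.extend (a : Assignment) (u : Var) (b : Bool) : Assignment :=
  Function.update a u (some b)

/-- A clause is falsified by `a` if `a` is defined on its variables and makes every literal
false. -/
def Falsifies (a : Assignment) (C : Clause) : Prop := ∀ L ∈ C.lits, a L.1 = some (!L.2)

/-- The label `(S, a)` of a node of a trace. -/
@[ext]
structure Label where
  S : Finset LocVar
  a : Assignment

/-- The label `(∅, e)`, where `e` is the assignment with empty domain. -/
def Label.init : Label := ⟨∅, fun _ => none⟩

/-- `S` is a coherent set of located variables and `a` is an assignment with domain `vars(S)`. -/
def IsLabel (ψ : QCBF) (l : Label) : Prop :=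
  IsCoherent ψ l.S ∧ ∀ v : Var, l.a v ≠ none ↔ v ∈ varsOf l.S

/-- The `(falsify)` step succeeds on the label `l` at the location `i`. -/
def CanFalsify (ψ : QCBF) (l : Label) (i : Loc) : Prop :=
  ∃ C, ψ.at? i = some (.clause C) ∧ FollowsSet ψ i l.S ∧ Falsifies l.a C ∧
    C.vars = varsOf l.S

/-- The labels `l₀, l₁` can be generated from `l` by a `(Q-branch)` step. -/
def IsQBranch (ψ : QCBF) (l l₀ l₁ : Label) : Prop :=
  ∃ (x : LocVar) (S₀ S₁ : Finset LocVar),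
    IsLocated ψ x ∧ x ∉ l.S ∧ IsCoherent ψ (insert x l.S) ∧ S₀ ∪ S₁ = l.S ∧
    l₀ = ⟨insert x S₀, (l.a.restrict (varsOf S₀)).extend x.2 false⟩ ∧
    l₁ = ⟨insert x S₁, (l.a.restrict (varsOf S₁)).extend x.2 true⟩

/-- The label `l₁` can be generated from `l` by a `(∀-branch)` step. -/
def IsAllBranch (ψ : QCBF) (l l₁ : Label) : Prop :=
  ∃ (x : LocVar) (b : Bool),
    IsAllLocated ψ x ∧ FollowsSet ψ x.1 l.S ∧ l₁ = ⟨insert x l.S, l.a.extend x.2 b⟩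

/-- Rooted trees with labels, in which a node has at most two children and a leaf has an
associated location. The children of a node with two children are listed with the branch
`u → 0` first. -/
inductive TraceTree : Type
  | leaf (l : Label) (i : Loc) : TraceTree
  | one (l : Label) (T : TraceTree) : TraceTree
  | two (l : Label) (T₀ T₁ : TraceTree) : TraceTree

/-- The root label. -/
def TraceTree.root : TraceTree → Label
  | .leaf l _ => l
  | .one l _ => l
  | .two l _ _ => l

/-- The number of nodes. -/
def TraceTree.numNodes : TraceTree → ℕ
  | .leaf _ _ => 1
  | .one _ T => T.numNodes + 1
  | .two _ T₀ T₁ => T₀.numNodes + T₁.numNodes + 1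

/-- Traces of `ψ`. -/
inductive IsTrace (ψ : QCBF) : TraceTree → Prop
  | leaf {l : Label} {i : Loc} (hl : IsLabel ψ l) (h : CanFalsify ψ l i) :
      IsTrace ψ (.leaf l i)
  | one {l : Label} {T : TraceTree} (hl : IsLabel ψ l) (h : IsAllBranch ψ l T.root)
      (hT : IsTrace ψ T) : IsTrace ψ (.one l T)
  | two {l : Label} {T₀ T₁ : TraceTree} (hl : IsLabel ψ l) (h : IsQBranch ψ l T₀.root T₁.root)
      (h₀ : IsTrace ψ T₀) (h₁ : IsTrace ψ T₁) : IsTrace ψ (.two l T₀ T₁)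

/-- `T` is a trace of `ψ` whose root has label `(∅, e)`. -/
def IsRootTrace (ψ : QCBF) (T : TraceTree) : Prop := IsTrace ψ T ∧ T.root = Label.init

/-! ### Polynomial time

Computations are those of a first-order functional language with recursion on binary trees (as
in Lisp without sharing). Every evaluation step is charged one unit plus the size of the value that
it produces, so that values of superpolynomial size cannot be built in polynomial cost; hence
polynomial cost here is the same as polynomial time on Turing machines. -/

/-- Binary trees, the data of programs. -/
inductive Datum : Type
  | nil : Datum
  | cons (x y : Datum) : Datum
  deriving DecidableEq

namespace Datum

/-- The number of nodes of a binary tree. -/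
def size : Datum → ℕ
  | nil => 1
  | cons x y => x.size + y.size + 1

/-- The left component. -/
def hd : Datum → Datum
  | nil => nil
  | cons x _ => x

/-- The right component. -/
def tl : Datum → Datum
  | nil => nil
  | cons _ y => y

/-- Truth values. -/
def ofBool : Bool → Datum
  | false => nil
  | true => cons nil nil

/-- Lists. -/
def ofList : List Datum → Datum
  | [] => nil
  | x :: l => cons x (ofList l)

/-- Natural numbers in unary, used for child numbers in paths and for tags. -/
def unary (k : ℕ) : Datum := ofList (List.replicate k nil)

/-- Natural numbers in binary, used for the names of variables. -/
def binary (v : ℕ) : Datum := ofList (v.bits.map ofBool)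

/-- Paths. -/
def ofLoc (i : Loc) : Datum := ofList (i.map unary)

/-- Pairs of a variable and a truth value. -/
def ofLiteral (L : Literal) : Datum := cons (binary L.1) (ofBool L.2)

/-- Located variables. -/
def ofLocVar (x : LocVar) : Datum := cons (ofLoc x.1) (binary x.2)

end Datum

/-- Programs. A program is the body of a function of one argument, which may call itself. -/
inductive Prog : Type
  /-- the current argument -/
  | arg : Prog
  | nil : Prog
  | cons (e₁ e₂ : Prog) : Prog
  | hd (e : Prog) : Prog
  | tl (e : Prog) : Prog
  /-- test for equality -/
  | eq (e₁ e₂ : Prog) : Prog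
  /-- if `c` is not `nil` then `e₁` else `e₂` -/
  | ite (c e₁ e₂ : Prog) : Prog
  /-- `e₂`, with the value of `e₁` as the current argument -/
  | bind (e₁ e₂ : Prog) : Prog
  /-- the enclosing function, called on the value of `e` -/
  | call (e : Prog) : Prog
  /-- the local function with body `f`, called on the value of `e` -/
  | app (f e : Prog) : Prog

/-- `Eval f x e v t`: inside the function with body `f`, with current argument `x`, the evaluation
of `e` ends with value `v` and has cost `t`. -/
inductive Eval : Prog → Datum → Prog → Datum → ℕ → Prop
  | arg {f : Prog} {x : Datum} : Eval f x .arg x (1 + x.size)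
  | nil {f : Prog} {x : Datum} : Eval f x .nil .nil (1 + Datum.nil.size)
  | cons {f e₁ e₂ : Prog} {x v₁ v₂ : Datum} {t₁ t₂ : ℕ}
      (h₁ : Eval f x e₁ v₁ t₁) (h₂ : Eval f x e₂ v₂ t₂) :
      Eval f x (.cons e₁ e₂) (.cons v₁ v₂) (t₁ + t₂ + 1 + (Datum.cons v₁ v₂).size)
  | hd {f e : Prog} {x v : Datum} {t : ℕ} (h : Eval f x e v t) :
      Eval f x (.hd e) v.hd (t + 1 + v.hd.size)
  | tl {f e : Prog} {x v : Datum} {t : ℕ} (h : Eval f x e v t) :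
      Eval f x (.tl e) v.tl (t + 1 + v.tl.size)
  | eq {f e₁ e₂ : Prog} {x v₁ v₂ : Datum} {t₁ t₂ : ℕ}
      (h₁ : Eval f x e₁ v₁ t₁) (h₂ : Eval f x e₂ v₂ t₂) :
      Eval f x (.eq e₁ e₂) (.ofBool (decide (v₁ = v₂)))
        (t₁ + t₂ + 1 + (Datum.ofBool (decide (v₁ = v₂))).size)
  | iteTrue {f c e₁ e₂ : Prog} {x w v : Datum} {s t : ℕ}
      (hc : Eval f x c w s) (hw : w ≠ .nil) (h : Eval f x e₁ v t) :
      Eval f x (.ite c e₁ e₂) v (s + t + 1 + v.size)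
  | iteFalse {f c e₁ e₂ : Prog} {x v : Datum} {s t : ℕ}
      (hc : Eval f x c .nil s) (h : Eval f x e₂ v t) :
      Eval f x (.ite c e₁ e₂) v (s + t + 1 + v.size)
  | bind {f e₁ e₂ : Prog} {x w v : Datum} {s t : ℕ}
      (h₁ : Eval f x e₁ w s) (h₂ : Eval f w e₂ v t) :
      Eval f x (.bind e₁ e₂) v (s + t + 1 + v.size)
  | call {f e : Prog} {x w v : Datum} {s t : ℕ}
      (h₁ : Eval f x e w s) (h₂ : Eval f w f v t) :
      Eval f x (.call e) v (s + t + 1 + v.size)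
  | app {f g e : Prog} {x w v : Datum} {s t : ℕ}
      (h₁ : Eval f x e w s) (h₂ : Eval g w g v t) :
      Eval f x (.app g e) v (s + t + 1 + v.size)

/-- The language is deterministic. -/
theorem Eval.unique {f e : Prog} {x v v' : Datum} {t t' : ℕ} (h : Eval f x e v t)
    (h' : Eval f x e v' t') : v = v' ∧ t = t' := by
  induction h generalizing v' t' with
  | arg => cases h'; exact ⟨rfl, rfl⟩
  | nil => cases h'; exact ⟨rfl, rfl⟩
  | cons _ _ ih₁ ih₂ =>
    cases h' with
    | cons k₁ k₂ =>
      obtain ⟨rfl, rfl⟩ := ih₁ k₁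
      obtain ⟨rfl, rfl⟩ := ih₂ k₂
      exact ⟨rfl, rfl⟩
  | eq _ _ ih₁ ih₂ =>
    cases h' with
    | eq k₁ k₂ =>
      obtain ⟨rfl, rfl⟩ := ih₁ k₁
      obtain ⟨rfl, rfl⟩ := ih₂ k₂
      exact ⟨rfl, rfl⟩
  | bind _ _ ih₁ ih₂ =>
    cases h' with
    | bind k₁ k₂ =>
      obtain ⟨rfl, rfl⟩ := ih₁ k₁
      obtain ⟨rfl, rfl⟩ := ih₂ k₂
      exact ⟨rfl, rfl⟩
  | call _ _ ih₁ ih₂ =>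
    cases h' with
    | call k₁ k₂ =>
      obtain ⟨rfl, rfl⟩ := ih₁ k₁
      obtain ⟨rfl, rfl⟩ := ih₂ k₂
      exact ⟨rfl, rfl⟩
  | app _ _ ih₁ ih₂ =>
    cases h' with
    | app k₁ k₂ =>
      obtain ⟨rfl, rfl⟩ := ih₁ k₁
      obtain ⟨rfl, rfl⟩ := ih₂ k₂
      exact ⟨rfl, rfl⟩
  | hd _ ih =>
    cases h' with
    | hd k =>
      obtain ⟨rfl, rfl⟩ := ih k
      exact ⟨rfl, rfl⟩
  | tl _ ih =>
    cases h' with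
    | tl k =>
      obtain ⟨rfl, rfl⟩ := ih k
      exact ⟨rfl, rfl⟩
  | iteTrue _ hw _ ih₁ ih₂ =>
    cases h' with
    | iteTrue k₁ _ k₂ =>
      obtain ⟨rfl, rfl⟩ := ih₁ k₁
      obtain ⟨rfl, rfl⟩ := ih₂ k₂
      exact ⟨rfl, rfl⟩
    | iteFalse k₁ _ => exact absurd (ih₁ k₁).1 hw
  | iteFalse _ _ ih₁ ih₂ =>
    cases h' with
    | iteTrue k₁ hw _ => exact absurd (ih₁ k₁).1.symm hw
    | iteFalse k₁ k₂ =>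
      obtain ⟨_, rfl⟩ := ih₁ k₁
      obtain ⟨rfl, rfl⟩ := ih₂ k₂
      exact ⟨rfl, rfl⟩

/-- A finite set is represented by any listing of its elements without repetition. -/
def RepSet {α : Type} (enc : α → Datum) (s : Set α) (d : Datum) : Prop :=
  ∃ l : List α, l.Nodup ∧ (∀ x, x ∈ l ↔ x ∈ s) ∧ d = .ofList (l.map enc)

/-- Representation of clauses. -/
def RepClause (C : Clause) (d : Datum) : Prop := RepSet Datum.ofLiteral (C.lits : Set Literal) d

/-- Representation of assignments (with finite domain), by their graphs. -/
def RepAssignment (a : Assignment) (d : Datum) : Prop :=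
  RepSet Datum.ofLiteral {p : Var × Bool | a p.1 = some p.2} d

/-- Representation of formulas. -/
inductive RepFormula : QCBF → Datum → Prop
  | clause {C : Clause} {d : Datum} (h : RepClause C d) :
      RepFormula (.clause C) (.cons (.unary 0) d)
  | conj {n : ℕ} {φ : Fin n → QCBF} {d : Fin n → Datum} (h : ∀ k, RepFormula (φ k) (d k)) :
      RepFormula (.conj n φ) (.cons (.unary 1) (.ofList (List.ofFn d)))
  | all {v : Var} {φ : QCBF} {d : Datum} (h : RepFormula φ d) :
      RepFormula (.all v φ) (.cons (.unary 2) (.cons (.binary v) d))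
  | ex {v : Var} {φ : QCBF} {d : Datum} (h : RepFormula φ d) :
      RepFormula (.ex v φ) (.cons (.unary 3) (.cons (.binary v) d))

/-- Representation of clause judgements. -/
def RepJudgement (J : Judgement) (d : Datum) : Prop :=
  ∃ c, RepClause J.clause c ∧ d = .cons (.ofLoc J.loc) c

/-- Representation of trees of judgements. -/
inductive RepProofTree : ProofTree → Datum → Prop
  | leaf {J : Judgement} {c : Datum} (hJ : RepJudgement J c) :
      RepProofTree (.leaf J) (.cons (.unary 0) c)
  | one {J : Judgement} {T : ProofTree} {c d : Datum} (hJ : RepJudgement J c)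
      (hT : RepProofTree T d) : RepProofTree (.one J T) (.cons (.unary 1) (.cons c d))
  | two {J : Judgement} {T₀ T₁ : ProofTree} {c d₀ d₁ : Datum} (hJ : RepJudgement J c)
      (h₀ : RepProofTree T₀ d₀) (h₁ : RepProofTree T₁ d₁) :
      RepProofTree (.two J T₀ T₁) (.cons (.unary 2) (.cons c (.cons d₀ d₁)))

/-- Representation of labels. -/
def RepLabel (l : Label) (d : Datum) : Prop :=
  ∃ s c, RepSet Datum.ofLocVar (l.S : Set LocVar) s ∧ RepAssignment l.a c ∧ d = .cons s c

/-- Representation of labelled trees. -/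
inductive RepTraceTree : TraceTree → Datum → Prop
  | leaf {l : Label} {i : Loc} {c : Datum} (hl : RepLabel l c) :
      RepTraceTree (.leaf l i) (.cons (.unary 0) (.cons c (.ofLoc i)))
  | one {l : Label} {T : TraceTree} {c d : Datum} (hl : RepLabel l c)
      (hT : RepTraceTree T d) : RepTraceTree (.one l T) (.cons (.unary 1) (.cons c d))
  | two {l : Label} {T₀ T₁ : TraceTree} {c d₀ d₁ : Datum} (hl : RepLabel l c)
      (h₀ : RepTraceTree T₀ d₀) (h₁ : RepTraceTree T₁ d₁) :
      RepTraceTree (.two l T₀ T₁) (.cons (.unary 2) (.cons c (.cons d₀ d₁)))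

/-- Representation of pairs. -/
def RepPair {α β : Type} (ra : α → Datum → Prop) (rb : β → Datum → Prop) (x : α × β)
    (d : Datum) : Prop :=
  ∃ a b, ra x.1 a ∧ rb x.2 b ∧ d = .cons a b

/-- The function `F` is computable in polynomial time on the inputs in `dom`: one program, with
cost bounded by a polynomial in the size of the representation of the input, turns every
representation of an input `x` in `dom` into a representation of `F x`. -/
def PolyTimeOn {α β : Type} (dom : α → Prop) (ra : α → Datum → Prop) (rb : β → Datum → Prop)
    (F : α → β) : Prop :=
  ∃ (f : Prog) (p : Polynomial ℕ), ∀ x, dom x → ∀ d, ra x d →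
    ∃ (d' : Datum) (t : ℕ), Eval f d f d' t ∧ t ≤ p.eval d.size ∧ rb (F x) d'

end QCBFTrace

open QCBFTrace

namespace QCBFTrace

/-! ### Polynomial-time functions on binary trees -/

/-! A judgement determines a label: each variable of its clause is paired with the quantifier that
binds it at the location, and the assignment is the one that falsifies the clause
(`Judgement.label`). A flow step keeps the clause, and the variables of the clause are free at both
ends, so they keep their binders and the label does not change (`IsFlowStep.label_eq`). The
remaining steps match the kinds of trace nodes: an axiom is a (falsify) leaf, a ∀-removal that
deletes a literal is a ∀-branch (`isAllBranch_label`), and resolution on `u` is a Q-branch on `u`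
(`isQBranch_label`). Contracting the flow steps therefore turns a proof into a trace with one node
per non-flow judgement (`ValidTree.toTrace_spec`), and the empty clause has the label `(∅, e)`.

Conversely, a label determines a clause but leaves the location open. Every location that follows a
coherent set `S` lies at or below `topLoc S`, the child of the deepest quantifier in `S` (the root
if `S` is empty), and all locations in between follow `S` too, so the clause can flow along that
path. `IsTrace.toProof_spec` derives the clause of each node at its top location. At a ∀-branch, the
top location of the child node is the child of the quantifier to be removed. At a Q-branch,
coherence makes the two top locations comparable (`IsCoherent.supports_of_length_le`): the shallower
premise flows down to the deeper one, the clauses are resolved there, and the resolvent flows up.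

Linear proofs are replaced by locally correct trees (`isTreeRefutation_iff`), because any such tree
can be written out as a tree-like sequence.

For polynomial time, both translations recurse on the tree, use each recursive result at most once,
and add a polynomially bounded amount at every node. Recursions of this kind stay in `PolyTime`
(`PolyTime.listRec`, `PolyTime.treeRec`). The translations are rewritten as functions on `Datum` and
shown to agree with the abstract ones on every representation (`RepProofTree.toTrace`,
`RepTraceTree.toProof`). A finite set may be listed in any order, so all tests have to be
independent of the listing. -/

theorem polynomial_eval_mono (p : Polynomial ℕ) : Monotone fun n => p.eval n := by
  intro m n h
  simp only [Polynomial.eval_eq_sum, Polynomial.sum]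
  exact Finset.sum_le_sum fun i _ => by gcongr

/-- A size function bounded by a polynomial in the size of its argument. -/
def PolyBounded (s : Datum → ℕ) : Prop := ∃ p : Polynomial ℕ, ∀ x, s x ≤ p.eval x.size

theorem PolyBounded.mono {s s' : Datum → ℕ} (h : PolyBounded s') (hs : ∀ x, s x ≤ s' x) :
    PolyBounded s := by
  obtain ⟨p, hp⟩ := h
  exact ⟨p, fun x => (hs x).trans (hp x)⟩

theorem PolyBounded.const (n : ℕ) : PolyBounded fun _ => n :=
  ⟨Polynomial.C n, fun x => by simp⟩

theorem PolyBounded.id : PolyBounded Datum.size := ⟨Polynomial.X, fun x => by simp⟩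

theorem PolyBounded.add {s s' : Datum → ℕ} (h : PolyBounded s) (h' : PolyBounded s') :
    PolyBounded fun x => s x + s' x := by
  obtain ⟨p, hp⟩ := h
  obtain ⟨p', hp'⟩ := h'
  exact ⟨p + p', fun x => by simpa using Nat.add_le_add (hp x) (hp' x)⟩

theorem PolyBounded.mul {s s' : Datum → ℕ} (h : PolyBounded s) (h' : PolyBounded s') :
    PolyBounded fun x => s x * s' x := by
  obtain ⟨p, hp⟩ := h
  obtain ⟨p', hp'⟩ := h'
  exact ⟨p * p', fun x => by simpa using Nat.mul_le_mul (hp x) (hp' x)⟩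

theorem PolyBounded.eval {s : Datum → ℕ} (q : Polynomial ℕ) (h : PolyBounded s) :
    PolyBounded fun x => q.eval (s x) := by
  obtain ⟨p, hp⟩ := h
  exact ⟨q.comp p, fun x => by simpa using polynomial_eval_mono q (hp x)⟩

/-- Every evaluation step is charged the size of its value, so a bound on the cost is also a bound
on the output. -/
theorem Eval.size_le {f e : Prog} {x v : Datum} {t : ℕ} (h : Eval f x e v t) : v.size ≤ t := by
  cases h <;> omega

/-- Needed where the value of the test is known to be `nil` only by a hypothesis, not by its form.
-/
theorem Eval.iteFalse_of_eq {f c e₁ e₂ : Prog} {x w v : Datum} {s t : ℕ}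
    (hc : Eval f x c w s) (hw : w = .nil) (h : Eval f x e₂ v t) :
    Eval f x (.ite c e₁ e₂) v (s + t + 1 + v.size) := by
  subst hw
  exact .iteFalse hc h

theorem Datum.size_pos (x : Datum) : 1 ≤ x.size := by
  cases x <;> simp [Datum.size]

theorem Datum.size_hd_le (x : Datum) : x.hd.size ≤ x.size := by
  cases x <;> simp [Datum.size, Datum.hd]; omega

theorem Datum.size_tl_le (x : Datum) : x.tl.size ≤ x.size := by
  cases x <;> simp [Datum.size, Datum.tl]; omega

theorem Datum.size_ofBool_le (b : Bool) : (Datum.ofBool b).size ≤ 3 := by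
  cases b <;> simp [Datum.size, Datum.ofBool]

/-- The functions computed in polynomial time by an expression that does not use the enclosing
function. -/
@[fun_prop]
def PolyTime (f : Datum → Datum) : Prop :=
  ∃ (e : Prog) (p : Polynomial ℕ), ∀ g x, ∃ t, Eval g x e (f x) t ∧ t ≤ p.eval x.size

theorem PolyTime.size_bounded {f : Datum → Datum} (h : PolyTime f) :
    PolyBounded fun x => (f x).size := by
  obtain ⟨e, p, h⟩ := h
  refine ⟨p, fun x => ?_⟩
  obtain ⟨t, ht, htp⟩ := h .nil x
  exact ht.size_le.trans htp

theorem PolyTime.of_bounded {f : Datum → Datum} (e : Prog) (s : Datum → ℕ) (hs : PolyBounded s)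
    (h : ∀ g x, ∃ t, Eval g x e (f x) t ∧ t ≤ s x) : PolyTime f := by
  obtain ⟨p, hp⟩ := hs
  refine ⟨e, p, fun g x => ?_⟩
  obtain ⟨t, ht, hts⟩ := h g x
  exact ⟨t, ht, hts.trans (hp x)⟩

@[fun_prop]
theorem PolyTime.id' : PolyTime fun x => x :=
  .of_bounded .arg _ ((PolyBounded.const 1).add .id) fun _ _ => ⟨_, .arg, le_rfl⟩

@[fun_prop]
theorem PolyTime.cons {f g : Datum → Datum} (hf : PolyTime f) (hg : PolyTime g) :
    PolyTime fun x => Datum.cons (f x) (g x) := by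
  obtain ⟨e₁, p₁, h₁⟩ := hf
  obtain ⟨e₂, p₂, h₂⟩ := hg
  refine ⟨.cons e₁ e₂, p₁ + p₂ + p₁ + p₂ + 2, fun k x => ?_⟩
  obtain ⟨t₁, ht₁, hp₁⟩ := h₁ k x
  obtain ⟨t₂, ht₂, hp₂⟩ := h₂ k x
  refine ⟨_, .cons ht₁ ht₂, ?_⟩
  have := ht₁.size_le
  have := ht₂.size_le
  simp [Datum.size]
  omega

@[fun_prop]
theorem PolyTime.const (d : Datum) : PolyTime fun _ => d := by
  induction d with
  | nil => exact ⟨.nil, 2, fun k x => ⟨_, .nil, by simp [Datum.size]⟩⟩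
  | cons x y hx hy => exact hx.cons hy

@[fun_prop]
theorem PolyTime.comp {f g : Datum → Datum} (hf : PolyTime f) (hg : PolyTime g) :
    PolyTime fun x => f (g x) := by
  obtain ⟨e₁, p₁, h₁⟩ := hf
  obtain ⟨e₂, p₂, h₂⟩ := hg
  refine ⟨.bind e₂ e₁, p₂ + p₁.comp p₂ + p₁.comp p₂ + 1, fun k x => ?_⟩
  obtain ⟨t₂, ht₂, hp₂⟩ := h₂ k x
  obtain ⟨t₁, ht₁, hp₁⟩ := h₁ k (g x)
  refine ⟨_, .bind ht₂ ht₁, ?_⟩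
  have := ht₁.size_le
  have := polynomial_eval_mono p₁ (ht₂.size_le.trans hp₂)
  simp at this ⊢
  omega

@[fun_prop]
theorem PolyTime.hd {f : Datum → Datum} (hf : PolyTime f) : PolyTime fun x => (f x).hd := by
  obtain ⟨e, p, h⟩ := hf
  refine ⟨.hd e, p + p + 1, fun k x => ?_⟩
  obtain ⟨t, ht, hp⟩ := h k x
  refine ⟨_, .hd ht, ?_⟩
  have := ht.size_le
  have := (f x).size_hd_le
  simp
  omega

@[fun_prop]
theorem PolyTime.tl {f : Datum → Datum} (hf : PolyTime f) : PolyTime fun x => (f x).tl := by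
  obtain ⟨e, p, h⟩ := hf
  refine ⟨.tl e, p + p + 1, fun k x => ?_⟩
  obtain ⟨t, ht, hp⟩ := h k x
  refine ⟨_, .tl ht, ?_⟩
  have := ht.size_le
  have := (f x).size_tl_le
  simp
  omega

namespace Datum

/-- The test for equality. -/
def beq (x y : Datum) : Datum := ofBool (decide (x = y))

/-- `y` if `c` is not `nil`, and `z` otherwise. -/
def cond : Datum → Datum → Datum → Datum
  | nil, _, z => z
  | cons _ _, y, _ => y

end Datum

@[fun_prop]
theorem PolyTime.beq {f g : Datum → Datum} (hf : PolyTime f) (hg : PolyTime g) :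
    PolyTime fun x => Datum.beq (f x) (g x) := by
  obtain ⟨e₁, p₁, h₁⟩ := hf
  obtain ⟨e₂, p₂, h₂⟩ := hg
  refine ⟨.eq e₁ e₂, p₁ + p₂ + 4, fun k x => ?_⟩
  obtain ⟨t₁, ht₁, hp₁⟩ := h₁ k x
  obtain ⟨t₂, ht₂, hp₂⟩ := h₂ k x
  refine ⟨_, .eq ht₁ ht₂, ?_⟩
  have := Datum.size_ofBool_le (decide (f x = g x))
  simp
  omega

@[fun_prop]
theorem PolyTime.cond {c f g : Datum → Datum} (hc : PolyTime c) (hf : PolyTime f)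
    (hg : PolyTime g) : PolyTime fun x => Datum.cond (c x) (f x) (g x) := by
  obtain ⟨e₀, p₀, h₀⟩ := hc
  obtain ⟨e₁, p₁, h₁⟩ := hf
  obtain ⟨e₂, p₂, h₂⟩ := hg
  refine ⟨.ite e₀ e₁ e₂, p₀ + p₁ + p₂ + p₁ + p₂ + 1, fun k x => ?_⟩
  obtain ⟨t₀, ht₀, hp₀⟩ := h₀ k x
  obtain ⟨t₁, ht₁, hp₁⟩ := h₁ k x
  obtain ⟨t₂, ht₂, hp₂⟩ := h₂ k x
  have := ht₁.size_le
  have := ht₂.size_le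
  cases hcx : c x with
  | nil =>
    rw [hcx] at ht₀
    simp only [hcx, Datum.cond]
    exact ⟨_, .iteFalse ht₀ ht₂, by simp; omega⟩
  | cons y z =>
    rw [hcx] at ht₀
    simp only [hcx, Datum.cond]
    exact ⟨_, .iteTrue ht₀ (by simp) ht₁, by simp; omega⟩

/-! ### Recursion on lists -/

/-- Recursion on lists with a parameter. -/
def listRec (b : Datum → Datum) (h : Datum → Datum → Datum → Datum → Datum) (c : Datum) :
    Datum → Datum
  | .nil => b c
  | .cons x y => h c x y (listRec b h c y)

/-- The program for recursion on lists. -/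
def Prog.listRec (b h : Prog) : Prog :=
  .ite (.tl .arg)
    (.bind (.cons .arg (.call (.cons (.hd .arg) (.tl (.tl .arg))))) h)
    (.bind (.hd .arg) b)

/-- The size hypothesis `hs` is what excludes exponential growth: a step function that doubles its
last argument is cheap, but iterating it is not. With all intermediate values bounded, every list
node costs a polynomial amount, and there are at most linearly many of them. -/
theorem PolyTime.listRec {b : Datum → Datum} {h : Datum → Datum → Datum → Datum → Datum}
    (hb : PolyTime b) (hh : PolyTime fun z => h z.hd.hd z.hd.tl.hd z.hd.tl.tl z.tl)
    (hs : PolyBounded fun z => (QCBFTrace.listRec b h z.hd z.tl).size)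
    {c l : Datum → Datum} (hc : PolyTime c) (hl : PolyTime l) :
    PolyTime fun x => QCBFTrace.listRec b h (c x) (l x) := by
  suffices hmain : PolyTime fun z => QCBFTrace.listRec b h z.hd z.tl from
    hmain.comp (hc.cons hl)
  obtain ⟨B, pb, hb⟩ := hb
  obtain ⟨H, ph, hh⟩ := hh
  obtain ⟨ps, hs⟩ := hs
  -- The allowance for one node of the list when parameter and list together have size at most `N`.
  -- It pays for one evaluation of `b` or `h` and for all values copied on the way; the numerical
  -- factors are generous.
  obtain ⟨K, hK⟩ : ∃ K : ℕ → ℕ, K = fun N => 60 * N + 10 * ps.eval N + 4 * pb.eval N +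
    4 * ph.eval (N + ps.eval N + 1) + 60 := ⟨_, rfl⟩
  have key : ∀ N c l, (Datum.cons c l).size ≤ N → ∃ t,
      Eval (.listRec B H) (.cons c l) (.listRec B H) (QCBFTrace.listRec b h c l) t ∧
        t ≤ l.size * K N := by
    intro N c l
    have hKN := congrFun hK N
    generalize K N = M at *
    induction l with
    | nil =>
      intro hN
      obtain ⟨t, ht, htb⟩ := hb (.listRec B H) c
      refine ⟨_, .iteFalse (.tl .arg) (.bind (.hd .arg) ht), ?_⟩
      have h1 := ht.size_le
      have h2 := polynomial_eval_mono pb (show c.size ≤ N by simp [Datum.size] at hN; omega)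
      simp only [Datum.size, Datum.hd, Datum.tl, QCBFTrace.listRec] at *
      omega
    | cons x y _ ih =>
      intro hN
      have hN' : (Datum.cons c y).size ≤ N := by simp [Datum.size] at hN ⊢; omega
      obtain ⟨s, hs1, hs2⟩ := ih hN'
      obtain ⟨t, ht, htb⟩ := hh (.listRec B H)
        (.cons (.cons c (.cons x y)) (QCBFTrace.listRec b h c y))
      refine ⟨_, .iteTrue (.tl .arg) (by simp [Datum.tl])
        (.bind (.cons .arg (.call (.cons (.hd .arg) (.tl (.tl .arg))) hs1)) ht), ?_⟩
      have h1 := ht.size_le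
      have h2 := (hs (.cons c y)).trans (polynomial_eval_mono ps hN')
      simp only [Datum.hd, Datum.tl] at h2
      have h3 := polynomial_eval_mono ph (show (Datum.cons (.cons c (.cons x y))
        (QCBFTrace.listRec b h c y)).size ≤ N + ps.eval N + 1 by
          simp only [Datum.size] at *; omega)
      simp only [Datum.size, Datum.hd, Datum.tl, QCBFTrace.listRec] at *
      have : (x.size + y.size + 1) * M = x.size * M + y.size * M + M := by ring
      omega
  refine .of_bounded (.app (.listRec B H) (.cons (.hd .arg) (.tl .arg)))
    (fun z => (z.size + 2) * K (z.size + 2) + 20 * (z.size + 2) + ps.eval (z.size + 2))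
    ?_ fun k z => ?_
  · have hz := PolyBounded.id.add (.const 2)
    refine (hz.mul ?_ |>.add ((PolyBounded.const 20).mul hz)).add (hz.eval ps)
    rw [hK]
    exact (((((PolyBounded.const 60).mul hz).add
      ((PolyBounded.const 10).mul (hz.eval ps))).add
      ((PolyBounded.const 4).mul (hz.eval pb))).add
      ((PolyBounded.const 4).mul (((hz.add (hz.eval ps)).add (.const 1)).eval ph))).add
      (.const 60)
  -- The `+ 2` is for `z = nil`, whose two components form a pair of size 3.
  · have hN : (Datum.cons z.hd z.tl).size ≤ z.size + 2 := by
      cases z <;> simp [Datum.size, Datum.hd, Datum.tl]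
    obtain ⟨t, ht, htb⟩ := key _ _ _ hN
    refine ⟨_, .app (.cons (.hd .arg) (.tl .arg)) ht, ?_⟩
    have h1 := (hs z).trans (polynomial_eval_mono ps (show z.size ≤ z.size + 2 by omega))
    have h2 : z.tl.size * K (z.size + 2) ≤ (z.size + 2) * K (z.size + 2) :=
      Nat.mul_le_mul_right _ (z.size_tl_le.trans (by omega))
    simp only [Datum.size] at *
    omega

/-! ### Recursion on trees with tags -/

theorem Datum.size_hd_add_size_tl_le (x : Datum) : x.hd.size + x.tl.size ≤ x.size + 1 := by
  cases x <;> simp [Datum.size, Datum.hd, Datum.tl]; omega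

theorem Datum.size_hd_add_size_tl {x : Datum} (h : x.hd ≠ .nil) :
    x.hd.size + x.tl.size + 1 = x.size := by
  cases x with
  | nil => exact absurd rfl h
  | cons x y => rfl

theorem Datum.size_tl_tl_add {x : Datum} (h : x.hd ≠ .nil) : x.tl.tl.size + 2 ≤ x.size := by
  have := size_hd_add_size_tl h
  have := x.hd.size_pos
  have := x.tl.size_tl_le
  omega

/-- A nonempty tag takes at least three nodes. Dropping it makes both branches smaller and leaves
spare units that pay for the current node in the inductions on size. -/
theorem Datum.size_branches {x : Datum} (h : x.hd ≠ .nil) :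
    x.tl.tl.hd.size + x.tl.tl.tl.size + 2 ≤ x.size := by
  have := size_hd_add_size_tl h
  have := x.tl.size_tl_le
  have := x.tl.tl.size_hd_add_size_tl_le
  have : 3 ≤ x.hd.size := by
    cases hx : x.hd with
    | nil => exact absurd hx h
    | cons y z =>
      have := y.size_pos
      have := z.size_pos
      simp only [Datum.size]
      omega
  omega

/-- Recursion on trees with tags, in which a node has at most two children. -/
def treeRec (h₀ : Datum → Datum → Datum) (h₁ : Datum → Datum → Datum → Datum)
    (h₂ : Datum → Datum → Datum → Datum → Datum) (c x : Datum) : Datum :=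
  if _h : x.hd = .nil then h₀ c x
  else if x.hd.tl = .nil then h₁ c x (treeRec h₀ h₁ h₂ c x.tl.tl)
  else h₂ c x (treeRec h₀ h₁ h₂ c x.tl.tl.hd) (treeRec h₀ h₁ h₂ c x.tl.tl.tl)
termination_by x.size
decreasing_by
  · have := Datum.size_tl_tl_add _h; omega
  · have := Datum.size_branches _h; have := x.tl.tl.tl.size_pos; omega
  · have := Datum.size_branches _h; omega

/-- The program for recursion on trees with tags. -/
def Prog.treeRec (h₀ h₁ h₂ : Prog) : Prog :=
  .ite (.hd (.tl .arg))
    (.ite (.tl (.hd (.tl .arg)))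
      (.bind (.cons .arg
        (.cons (.call (.cons (.hd .arg) (.hd (.tl (.tl (.tl .arg))))))
          (.call (.cons (.hd .arg) (.tl (.tl (.tl (.tl .arg)))))))) h₂)
      (.bind (.cons .arg (.call (.cons (.hd .arg) (.tl (.tl (.tl .arg)))))) h₁))
    h₀

/-- Each node adds to the recursive results at most an amount that depends on the input alone, so
the total is at most the number of nodes times this amount. A constant factor in front of `r.size`
would compound along the depth. -/
theorem treeRec_size_le {h₀ : Datum → Datum → Datum} {h₁ : Datum → Datum → Datum → Datum}
    {h₂ : Datum → Datum → Datum → Datum → Datum} {q₀ q₁ q₂ : Polynomial ℕ} {c : Datum}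
    (b₀ : ∀ x, (h₀ c x).size ≤ q₀.eval (Datum.cons c x).size)
    (b₁ : ∀ x r, (h₁ c x r).size ≤ r.size + q₁.eval (Datum.cons c x).size)
    (b₂ : ∀ x r r', (h₂ c x r r').size ≤ r.size + r'.size + q₂.eval (Datum.cons c x).size)
    {N : ℕ} (x : Datum) (hN : (Datum.cons c x).size ≤ N) :
    (treeRec h₀ h₁ h₂ c x).size ≤ x.size * (q₀.eval N + q₁.eval N + q₂.eval N) := by
  obtain ⟨K, hK⟩ : ∃ K, K = q₀.eval N + q₁.eval N + q₂.eval N := ⟨_, rfl⟩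
  rw [← hK]
  induction hn : x.size using Nat.strong_induction_on generalizing x with
  | _ n ih =>
    have hm : ∀ y : Datum, y.size ≤ x.size → (Datum.cons c y).size ≤ N := fun y hy => by
      simp only [Datum.size] at *; omega
    rw [treeRec]
    split_ifs with h h'
    · have h1 := polynomial_eval_mono q₀ hN
      have h2 : 1 * K ≤ n * K := Nat.mul_le_mul_right _ (hn ▸ x.size_pos)
      have h3 := b₀ x
      simp only at h1
      omega
    · have hs := Datum.size_tl_tl_add h
      have h1 := polynomial_eval_mono q₁ hN
      have h2 : (x.tl.tl.size + 1) * K ≤ n * K := Nat.mul_le_mul_right _ (by omega)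
      have h3 := b₁ x (treeRec h₀ h₁ h₂ c x.tl.tl)
      have h4 := ih _ (by omega) x.tl.tl (hm _ (by omega)) rfl
      simp only [add_mul, one_mul] at h1 h2
      omega
    · have hs := Datum.size_branches h
      have h1 := polynomial_eval_mono q₂ hN
      have h2 : (x.tl.tl.hd.size + x.tl.tl.tl.size + 1) * K ≤ n * K :=
        Nat.mul_le_mul_right _ (by omega)
      have h3 := b₂ x (treeRec h₀ h₁ h₂ c x.tl.tl.hd) (treeRec h₀ h₁ h₂ c x.tl.tl.tl)
      have h4 := ih _ (by omega) x.tl.tl.hd (hm _ (by omega)) rfl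
      have h5 := ih _ (by omega) x.tl.tl.tl (hm _ (by omega)) rfl
      simp only [add_mul, one_mul] at h1 h2
      omega

/-- The growth conditions `b₁` and `b₂` bound all intermediate values by `treeRec_size_le`; the cost
is then summed over the nodes as in `PolyTime.listRec`. -/
theorem PolyTime.treeRec {h₀ : Datum → Datum → Datum} {h₁ : Datum → Datum → Datum → Datum}
    {h₂ : Datum → Datum → Datum → Datum → Datum}
    (t₀ : PolyTime fun z => h₀ z.hd z.tl)
    (t₁ : PolyTime fun z => h₁ z.hd.hd z.hd.tl z.tl)
    (t₂ : PolyTime fun z => h₂ z.hd.hd z.hd.tl z.tl.hd z.tl.tl)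
    (b₁ : ∃ q : Polynomial ℕ, ∀ c x r,
      (h₁ c x r).size ≤ r.size + q.eval (Datum.cons c x).size)
    (b₂ : ∃ q : Polynomial ℕ, ∀ c x r r',
      (h₂ c x r r').size ≤ r.size + r'.size + q.eval (Datum.cons c x).size)
    {c x : Datum → Datum} (hc : PolyTime c) (hx : PolyTime x) :
    PolyTime fun z => QCBFTrace.treeRec h₀ h₁ h₂ (c z) (x z) := by
  suffices hmain : PolyTime fun z => QCBFTrace.treeRec h₀ h₁ h₂ z.hd z.tl from
    hmain.comp (hc.cons hx)
  obtain ⟨q₀, b₀⟩ := t₀.size_bounded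
  obtain ⟨q₁, b₁⟩ := b₁
  obtain ⟨q₂, b₂⟩ := b₂
  obtain ⟨e₀, p₀, t₀⟩ := t₀
  obtain ⟨e₁, p₁, t₁⟩ := t₁
  obtain ⟨e₂, p₂, t₂⟩ := t₂
  obtain ⟨B, hB⟩ : ∃ B : ℕ → ℕ, B = fun N => N * (q₀.eval N + q₁.eval N + q₂.eval N) := ⟨_, rfl⟩
  have hs : ∀ N c x, (Datum.cons c x).size ≤ N →
      (QCBFTrace.treeRec h₀ h₁ h₂ c x).size ≤ B N := by
    intro N c x hN
    refine (treeRec_size_le (fun x => b₀ (.cons c x)) (b₁ c) (b₂ c) x hN).trans ?_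
    rw [hB]
    exact Nat.mul_le_mul_right _ (by simp only [Datum.size] at hN; omega)
  obtain ⟨K, hK⟩ : ∃ K : ℕ → ℕ, K = fun N => 100 * N + 20 * B N + 4 * p₀.eval N +
    4 * p₁.eval (N + B N + 1) + 4 * p₂.eval (N + B N + B N + 2) + 100 := ⟨_, rfl⟩
  have key : ∀ N c x, (Datum.cons c x).size ≤ N → ∃ t,
      Eval (.treeRec e₀ e₁ e₂) (.cons c x) (.treeRec e₀ e₁ e₂)
        (QCBFTrace.treeRec h₀ h₁ h₂ c x) t ∧ t ≤ x.size * K N := by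
    intro N c x
    have hKN := congrFun hK N
    have hs := hs N c
    -- With opaque bounds, the products with `K` are atoms for `omega`.
    generalize B N = B at *
    generalize K N = K at *
    induction hn : x.size using Nat.strong_induction_on generalizing x with
    | _ n ih =>
      intro hN
      have hm : ∀ y : Datum, y.size ≤ x.size → (Datum.cons c y).size ≤ N := fun y hy => by
        simp only [Datum.size] at *; omega
      have l₁ := x.size_hd_le
      have l₂ := x.size_tl_le
      have l₃ := x.hd.size_tl_le
      have l₄ := x.tl.size_tl_le
      have l₅ := x.tl.tl.size_tl_le
      have l₆ := x.tl.tl.size_hd_le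
      have hs0 := hs x hN
      by_cases h : x.hd = .nil
      · have heq : QCBFTrace.treeRec h₀ h₁ h₂ c x = h₀ c x := by
          rw [QCBFTrace.treeRec, dif_pos h]
        rw [heq] at hs0 ⊢
        obtain ⟨t, ht, htb⟩ := t₀ (.treeRec e₀ e₁ e₂) (.cons c x)
        refine ⟨_, .iteFalse_of_eq (.hd (.tl .arg)) h ht, ?_⟩
        have h1 := polynomial_eval_mono p₀ hN
        have h2 : 1 * K ≤ n * K := Nat.mul_le_mul_right _ (hn ▸ x.size_pos)
        simp only [Datum.size, Datum.hd, Datum.tl] at *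
        omega
      by_cases h' : x.hd.tl = .nil
      · have heq : QCBFTrace.treeRec h₀ h₁ h₂ c x =
            h₁ c x (QCBFTrace.treeRec h₀ h₁ h₂ c x.tl.tl) := by
          rw [QCBFTrace.treeRec, dif_neg h, if_pos h']
        rw [heq] at hs0 ⊢
        have hsz := Datum.size_tl_tl_add h
        have hs1 := hs x.tl.tl (hm _ (by omega))
        obtain ⟨s, hs2, hsb⟩ := ih _ (by omega) x.tl.tl rfl (hm _ (by omega))
        obtain ⟨t, ht, htb⟩ := t₁ (.treeRec e₀ e₁ e₂)
          (.cons (.cons c x) (QCBFTrace.treeRec h₀ h₁ h₂ c x.tl.tl))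
        refine ⟨_, .iteTrue (.hd (.tl .arg)) h (.iteFalse_of_eq (.tl (.hd (.tl .arg))) h'
          (.bind (.cons .arg (.call (.cons (.hd .arg) (.tl (.tl (.tl .arg)))) hs2)) ht)), ?_⟩
        have h1 := polynomial_eval_mono p₁ (show (Datum.cons (.cons c x)
          (QCBFTrace.treeRec h₀ h₁ h₂ c x.tl.tl)).size ≤ N + B + 1 by
            simp only [Datum.size] at *; omega)
        have h2 : (x.tl.tl.size + 1) * K ≤ n * K := Nat.mul_le_mul_right _ (by omega)
        simp only [Datum.size, Datum.hd, Datum.tl, add_mul, one_mul] at *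
        omega
      · have heq : QCBFTrace.treeRec h₀ h₁ h₂ c x =
            h₂ c x (QCBFTrace.treeRec h₀ h₁ h₂ c x.tl.tl.hd)
              (QCBFTrace.treeRec h₀ h₁ h₂ c x.tl.tl.tl) := by
          rw [QCBFTrace.treeRec, dif_neg h, if_neg h']
        rw [heq] at hs0 ⊢
        have hsz := Datum.size_branches h
        have hs1 := hs x.tl.tl.hd (hm _ (by omega))
        have hs1' := hs x.tl.tl.tl (hm _ (by omega))
        have hpos := x.tl.tl.tl.size_pos
        obtain ⟨s, hs2, hsb⟩ := ih _ (by omega) x.tl.tl.hd rfl (hm _ (by omega))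
        obtain ⟨s', hs2', hsb'⟩ := ih _ (by omega) x.tl.tl.tl rfl (hm _ (by omega))
        obtain ⟨t, ht, htb⟩ := t₂ (.treeRec e₀ e₁ e₂)
          (.cons (.cons c x) (.cons (QCBFTrace.treeRec h₀ h₁ h₂ c x.tl.tl.hd)
            (QCBFTrace.treeRec h₀ h₁ h₂ c x.tl.tl.tl)))
        refine ⟨_, .iteTrue (.hd (.tl .arg)) h (.iteTrue (.tl (.hd (.tl .arg))) h'
          (.bind (.cons .arg (.cons
            (.call (.cons (.hd .arg) (.hd (.tl (.tl (.tl .arg))))) hs2)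
            (.call (.cons (.hd .arg) (.tl (.tl (.tl (.tl .arg))))) hs2'))) ht)), ?_⟩
        have h1 := polynomial_eval_mono p₂ (show (Datum.cons (.cons c x)
          (.cons (QCBFTrace.treeRec h₀ h₁ h₂ c x.tl.tl.hd)
            (QCBFTrace.treeRec h₀ h₁ h₂ c x.tl.tl.tl))).size ≤ N + B + B + 2 by
            simp only [Datum.size] at *; omega)
        have h2 : (x.tl.tl.hd.size + x.tl.tl.tl.size + 1) * K ≤ n * K :=
          Nat.mul_le_mul_right _ (by omega)
        simp only [Datum.size, Datum.hd, Datum.tl, add_mul, one_mul] at *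
        omega
  refine .of_bounded (.app (.treeRec e₀ e₁ e₂) (.cons (.hd .arg) (.tl .arg)))
    (fun z => (z.size + 2) * K (z.size + 2) + 20 * (z.size + 2) + B (z.size + 2))
    ?_ fun k z => ?_
  · have hz := PolyBounded.id.add (.const 2)
    have hBz : PolyBounded fun z => B (z.size + 2) := by
      rw [hB]
      exact hz.mul (((hz.eval q₀).add (hz.eval q₁)).add (hz.eval q₂))
    refine (hz.mul ?_ |>.add ((PolyBounded.const 20).mul hz)).add hBz
    rw [hK]
    exact ((((((PolyBounded.const 100).mul hz).add
      ((PolyBounded.const 20).mul hBz)).add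
      ((PolyBounded.const 4).mul (hz.eval p₀))).add
      ((PolyBounded.const 4).mul (((hz.add hBz).add (.const 1)).eval p₁))).add
      ((PolyBounded.const 4).mul ((((hz.add hBz).add hBz).add (.const 2)).eval p₂))).add
      (.const 100)
  · have hN : (Datum.cons z.hd z.tl).size ≤ z.size + 2 := by
      cases z <;> simp [Datum.size, Datum.hd, Datum.tl]
    obtain ⟨t, ht, htb⟩ := key _ _ _ hN
    refine ⟨_, .app (.cons (.hd .arg) (.tl .arg)) ht, ?_⟩
    have h1 := hs _ _ _ hN
    have h2 : z.tl.size * K (z.size + 2) ≤ (z.size + 2) * K (z.size + 2) :=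
      Nat.mul_le_mul_right _ (z.size_tl_le.trans (by omega))
    simp only [Datum.size] at *
    omega

/-! ### Operations on lists in polynomial time -/

namespace Datum

theorem ofList_cons (x : Datum) (l : List Datum) : ofList (x :: l) = cons x (ofList l) := rfl

theorem ofList_injective : Function.Injective ofList := by
  intro l
  induction l with
  | nil => intro m h; cases m <;> simp_all [ofList]
  | cons x l ih =>
    intro m h
    cases m with
    | nil => simp [ofList] at h
    | cons y m =>
      simp only [ofList, cons.injEq] at h
      rw [h.1, ih h.2]

theorem ofList_eq_nil {l : List Datum} : ofList l = nil ↔ l = [] :=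
  ofList_injective.eq_iff (b := [])

theorem cond_eq_ite (c x y : Datum) : cond c x y = if c = nil then y else x := by
  cases c <;> simp [cond]

theorem cond_ofBool (b : Bool) (x y : Datum) : cond (ofBool b) x y = if b then x else y := by
  cases b <;> rfl

theorem ofBool_eq_nil {b : Bool} : ofBool b = nil ↔ b = false := by
  cases b <;> simp [ofBool]

theorem ofBool_injective : Function.Injective ofBool := by
  intro b b'
  cases b <;> cases b' <;> simp [ofBool]

theorem beq_eq_nil {x y : Datum} : beq x y = nil ↔ x ≠ y := by
  simp [beq, ofBool_eq_nil]

/-- Negation of truth values. -/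
def not (x : Datum) : Datum := beq x nil

theorem not_eq_nil {x : Datum} : not x = nil ↔ x ≠ nil := beq_eq_nil

theorem not_ofBool (b : Bool) : not (ofBool b) = ofBool (!b) := by
  cases b <;> rfl

/-- The image of a list under a function with a parameter. -/
def map (g : Datum → Datum → Datum) (c l : Datum) : Datum :=
  listRec (fun _ => nil) (fun c x _ r => cons (g c x) r) c l

theorem map_ofList (g : Datum → Datum → Datum) (c : Datum) (l : List Datum) :
    map g c (ofList l) = ofList (l.map (g c)) := by
  induction l with
  | nil => rfl
  | cons x l ih => exact congrArg (cons (g c x)) ih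

/-- The sublist of the elements with a property with a parameter. -/
def filter (g : Datum → Datum → Datum) (c l : Datum) : Datum :=
  listRec (fun _ => nil) (fun c x _ r => cond (g c x) (cons x r) r) c l

theorem filter_cons (g : Datum → Datum → Datum) (c x y : Datum) :
    filter g c (cons x y) = cond (g c x) (cons x (filter g c y)) (filter g c y) := rfl

/-- The test has to be correct only on the elements of the list. This matters for locations, where
the test for a quantifier is meaningful only if the location exists. -/
theorem filter_map_ofList {α : Type} (enc : α → Datum) (g : Datum → Datum → Datum) (c : Datum)
    (p : α → Bool) (l : List α) (h : ∀ x ∈ l, g c (enc x) ≠ nil ↔ p x = true) :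
    filter g c (ofList (l.map enc)) = ofList ((l.filter p).map enc) := by
  induction l with
  | nil => rfl
  | cons x l ih =>
    rw [List.map_cons, ofList_cons, filter_cons, ih fun y hy => h y (List.mem_cons_of_mem _ hy),
      cond_eq_ite, List.filter_cons]
    have hx := h x List.mem_cons_self
    by_cases hp : p x = true
    · rw [if_neg (hx.2 hp), if_pos hp]; rfl
    · rw [if_pos (not_not.1 fun hn => hp (hx.1 hn)), if_neg hp]

theorem size_filter_le (g : Datum → Datum → Datum) (c l : Datum) :
    (filter g c l).size ≤ l.size := by
  induction l with
  | nil => exact le_rfl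
  | cons x y _ ih =>
    rw [filter_cons, cond_eq_ite]
    split_ifs <;> simp only [size] <;> omega

/-- Concatenation. -/
def append (l m : Datum) : Datum := listRec (fun c => c) (fun _ x _ r => cons x r) m l

theorem append_cons (x y m : Datum) : append (cons x y) m = cons x (append y m) := rfl

theorem append_ofList (l m : List Datum) : append (ofList l) (ofList m) = ofList (l ++ m) := by
  induction l with
  | nil => rfl
  | cons x l ih => exact congrArg (cons x) ih

theorem size_append (l m : Datum) : (append l m).size + 1 = l.size + m.size := by
  induction l with
  | nil => simp only [append, listRec, size]; omega
  | cons x y _ ih => rw [append_cons]; simp only [size]; omega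

/-- The reversed list. -/
def reverse (l : Datum) : Datum :=
  listRec (fun _ => nil) (fun _ x _ r => append r (cons x nil)) nil l

theorem reverse_cons (x y : Datum) : reverse (cons x y) = append (reverse y) (cons x nil) := rfl

theorem reverse_ofList (l : List Datum) : reverse (ofList l) = ofList l.reverse := by
  induction l with
  | nil => rfl
  | cons x l ih =>
    rw [ofList_cons, reverse_cons, ih, List.reverse_cons]
    exact append_ofList _ [x]

/-- `l` without as many initial elements as `n` has elements. -/
def drop (l n : Datum) : Datum := listRec (fun c => c) (fun _ _ _ r => r.tl) l n

theorem drop_cons (l x n : Datum) : drop l (cons x n) = (drop l n).tl := rfl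

theorem tl_ofList (l : List Datum) : (ofList l).tl = ofList l.tail := by
  cases l <;> rfl

theorem drop_ofList (l n : List Datum) : drop (ofList l) (ofList n) = ofList (l.drop n.length) := by
  induction n with
  | nil => rfl
  | cons x n ih =>
    rw [ofList_cons, drop_cons, ih, tl_ofList, List.tail_drop, List.length_cons]

theorem size_drop_le (l n : Datum) : (drop l n).size ≤ l.size := by
  induction n with
  | nil => exact le_rfl
  | cons x y _ ih => rw [drop_cons]; exact (size_tl_le _).trans ih

/-- Comparison of lengths. -/
def lengthLE (l m : Datum) : Datum := not (drop l m)

theorem lengthLE_ofList (l m : List Datum) :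
    lengthLE (ofList l) (ofList m) ≠ nil ↔ l.length ≤ m.length := by
  rw [lengthLE, Ne, not_eq_nil, not_not, drop_ofList, ofList_eq_nil, List.drop_eq_nil_iff]

/-- Strict comparison of lengths. -/
def lengthLT (l m : Datum) : Datum := not (lengthLE m l)

theorem lengthLT_ofList (l m : List Datum) :
    lengthLT (ofList l) (ofList m) ≠ nil ↔ l.length < m.length := by
  rw [lengthLT, Ne, not_eq_nil, lengthLE_ofList, not_le]

/-- Membership in a list. -/
def mem (x l : Datum) : Datum := filter beq x l

theorem mem_ofList (x : Datum) (l : List Datum) : mem x (ofList l) ≠ nil ↔ x ∈ l := by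
  have h := filter_map_ofList (fun x => x) beq x (fun y => decide (x = y)) l
    fun y _ => by simp [beq_eq_nil]
  rw [List.map_id', List.map_id'] at h
  rw [mem, h, Ne, ofList_eq_nil, List.filter_eq_nil_iff]
  simp

/-- The initial segments of a list. -/
def inits (l : Datum) : Datum :=
  listRec (fun _ => cons nil nil) (fun _ x _ r => cons nil (map cons x r)) nil l

theorem inits_cons (x y : Datum) : inits (cons x y) = cons nil (map cons x (inits y)) := rfl

theorem inits_ofList (l : List Datum) : inits (ofList l) = ofList (l.inits.map ofList) := by
  induction l with
  | nil => rfl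
  | cons x l ih =>
    rw [ofList_cons, inits_cons, ih, map_ofList, List.inits_cons, List.map_cons, List.map_map,
      List.map_map]
    rfl

/-- The number of elements of a list. -/
def length : Datum → ℕ
  | nil => 0
  | cons _ y => y.length + 1

theorem length_map (g : Datum → Datum → Datum) (c l : Datum) : (map g c l).length = l.length := by
  induction l with
  | nil => rfl
  | cons x y _ ih => exact congrArg (· + 1) ih

theorem length_le_size (l : Datum) : l.length ≤ l.size := by
  induction l with
  | nil => simp [length]
  | cons x y _ ih => simp only [length, size]; omega

theorem length_inits (l : Datum) : (inits l).length = l.length + 1 := by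
  induction l with
  | nil => rfl
  | cons x y _ ih => rw [inits_cons, length, length_map, ih, length]

theorem size_map_cons (x l : Datum) : (map cons x l).size = l.size + l.length * (x.size + 1) := by
  induction l with
  | nil => simp [map, listRec, size, length]
  | cons y z _ ih =>
    change (cons (cons x y) (map cons x z)).size = _
    simp only [size, length, ih]
    ring

/-- There are `l.length + 1` initial segments. Prefixing `x` to those of `y` costs `x.size + 1` for
each, which the increase of the quadratic bound covers. -/
theorem size_inits_le (l : Datum) : (inits l).size ≤ (l.size + 1) * (l.size + 2) := by
  induction l with
  | nil => simp [inits, listRec, size]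
  | cons x y _ ih =>
    rw [inits_cons]
    simp only [size, size_map_cons, length_inits]
    have := y.length_le_size
    have : (y.length + 1) * (x.size + 1) ≤ (y.size + 1) * (x.size + 1) :=
      Nat.mul_le_mul_right _ (by omega)
    nlinarith

end Datum

section ListOperations

open Datum

@[fun_prop]
theorem PolyTime.not {f : Datum → Datum} (hf : PolyTime f) : PolyTime fun x => Datum.not (f x) :=
  hf.beq (.const .nil)

theorem PolyTime.map {g : Datum → Datum → Datum} (hg : PolyTime fun z => g z.hd z.tl)
    {c l : Datum → Datum} (hc : PolyTime c) (hl : PolyTime l) :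
    PolyTime fun x => Datum.map g (c x) (l x) := by
  refine .listRec (.const _) ?_ ?_ hc hl
  · exact (hg.comp (f := fun z => g z.hd z.tl)
      (g := fun z => .cons z.hd.hd z.hd.tl.hd) (by fun_prop)).cons (by fun_prop)
  · obtain ⟨q, hq⟩ := hg.size_bounded
    have key : ∀ N c l, (Datum.cons c l).size ≤ N →
        (Datum.map g c l).size ≤ l.size * (q.eval N + 1) := by
      intro N c l hN
      induction l with
      | nil => simp [Datum.map, QCBFTrace.listRec, size]
      | cons x y _ ih =>
        have h1 := ih (by simp only [size] at *; omega)
        have h2 := (hq (.cons c x)).trans (polynomial_eval_mono q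
          (show (Datum.cons c x).size ≤ N by simp only [size] at *; omega))
        change (Datum.cons (g c x) (Datum.map g c y)).size ≤ _
        simp only [size, Datum.hd, Datum.tl, add_mul, one_mul] at *
        have := x.size_pos
        nlinarith
    refine PolyBounded.mono ((PolyBounded.id).mul
      (((PolyBounded.id.add (.const 2)).eval q).add (.const 1))) fun z => ?_
    refine (key (z.size + 2) z.hd z.tl (by
      cases z <;> simp [Datum.size, Datum.hd, Datum.tl])).trans ?_
    exact Nat.mul_le_mul_right _ z.size_tl_le

theorem PolyTime.filter {g : Datum → Datum → Datum} (hg : PolyTime fun z => g z.hd z.tl)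
    {c l : Datum → Datum} (hc : PolyTime c) (hl : PolyTime l) :
    PolyTime fun x => Datum.filter g (c x) (l x) := by
  refine .listRec (.const _) ?_ ?_ hc hl
  · exact (hg.comp (f := fun z => g z.hd z.tl)
      (g := fun z => .cons z.hd.hd z.hd.tl.hd) (by fun_prop)).cond (by fun_prop) (by fun_prop)
  · exact PolyBounded.id.mono fun z => (size_filter_le g z.hd z.tl).trans z.size_tl_le

@[fun_prop]
theorem PolyTime.append {f g : Datum → Datum} (hf : PolyTime f) (hg : PolyTime g) :
    PolyTime fun x => Datum.append (f x) (g x) := by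
  refine .listRec .id' (by fun_prop) ?_ hg hf
  refine (PolyBounded.id.add (.const 1)).mono fun z => ?_
  have h1 := size_append z.tl z.hd
  have h2 := z.size_hd_add_size_tl_le
  change (Datum.append z.tl z.hd).size ≤ _
  omega

@[fun_prop]
theorem PolyTime.reverse {f : Datum → Datum} (hf : PolyTime f) :
    PolyTime fun x => Datum.reverse (f x) := by
  refine .listRec (.const _) (by fun_prop) ?_ (.const .nil) hf
  refine PolyBounded.id.mono fun z => le_trans ?_ z.size_tl_le
  induction z.tl with
  | nil => exact le_rfl
  | cons x y _ ih =>
    have := size_append (QCBFTrace.listRec (fun _ => .nil)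
      (fun _ x _ r => Datum.append r (.cons x .nil)) z.hd y) (.cons x .nil)
    simp only [QCBFTrace.listRec, size] at *
    omega

@[fun_prop]
theorem PolyTime.drop {f g : Datum → Datum} (hf : PolyTime f) (hg : PolyTime g) :
    PolyTime fun x => Datum.drop (f x) (g x) := by
  refine .listRec .id' (by fun_prop) ?_ hf hg
  exact PolyBounded.id.mono fun z => (size_drop_le z.hd z.tl).trans z.size_hd_le

@[fun_prop]
theorem PolyTime.lengthLE {f g : Datum → Datum} (hf : PolyTime f) (hg : PolyTime g) :
    PolyTime fun x => Datum.lengthLE (f x) (g x) :=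
  (hf.drop hg).not

@[fun_prop]
theorem PolyTime.lengthLT {f g : Datum → Datum} (hf : PolyTime f) (hg : PolyTime g) :
    PolyTime fun x => Datum.lengthLT (f x) (g x) :=
  (hg.lengthLE hf).not

@[fun_prop]
theorem PolyTime.mem {f g : Datum → Datum} (hf : PolyTime f) (hg : PolyTime g) :
    PolyTime fun x => Datum.mem (f x) (g x) :=
  .filter (by fun_prop) hf hg

@[fun_prop]
theorem PolyTime.inits {f : Datum → Datum} (hf : PolyTime f) :
    PolyTime fun x => Datum.inits (f x) := by
  refine .listRec (.const _) ?_ ?_ (.const .nil) hf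
  · exact .cons (.const _) (.map (by fun_prop) (by fun_prop) (by fun_prop))
  · refine ((PolyBounded.id.add (.const 1)).mul (PolyBounded.id.add (.const 2))).mono fun z => ?_
    -- The size bound is required for every parameter, while the definition fixes `nil`; the
    -- recursion ignores the parameter.
    have h : ∀ c l, QCBFTrace.listRec (fun _ => .cons .nil .nil)
        (fun _ x _ r => .cons .nil (Datum.map .cons x r)) c l = Datum.inits l := by
      intro c l
      induction l with
      | nil => rfl
      | cons x y _ ih => rw [QCBFTrace.listRec, ih, inits_cons]
    rw [h]
    have := z.size_tl_le
    exact (size_inits_le _).trans (Nat.mul_le_mul (by omega) (by omega))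

end ListOperations

/-! ### Linear and tree-shaped proofs -/

/-- Trees of judgements in which every node is derived from its children. -/
inductive ValidTree (ψ : QCBF) : ProofTree → Prop
  | leaf {J : Judgement} (hJ : IsJudgement ψ J) (h : Derives ψ [] J) : ValidTree ψ (.leaf J)
  | one {J : Judgement} {T : ProofTree} (hJ : IsJudgement ψ J) (h : Derives ψ [T.root] J)
      (hT : ValidTree ψ T) : ValidTree ψ (.one J T)
  | two {J : Judgement} {T₀ T₁ : ProofTree} (hJ : IsJudgement ψ J)
      (h : Derives ψ [T₀.root, T₁.root] J) (h₀ : ValidTree ψ T₀) (h₁ : ValidTree ψ T₁) :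
      ValidTree ψ (.two J T₀ T₁)

theorem ValidTree.isJudgement {ψ : QCBF} {T : ProofTree} (h : ValidTree ψ T) :
    IsJudgement ψ T.root := by
  cases h <;> assumption

theorem Induces.judgement_root {P : List ProofLine} {t : ℕ} {T : ProofTree} (h : Induces P t T) :
    P[t]?.map ProofLine.judgement = some T.root := by
  cases h with
  | leaf h => rw [h]; rfl
  | one h _ => rw [h]; rfl
  | two h _ _ => rw [h]; rfl

theorem Induces.validTree {ψ : QCBF} {P : List ProofLine} (hP : IsClauseProof ψ P) {t : ℕ}
    {T : ProofTree} (h : Induces P t T) : ValidTree ψ T := by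
  induction h with
  | leaf h => exact .leaf (hP _ _ h).1 (hP _ _ h).2.2
  | one h hT ih =>
    refine .one (hP _ _ h).1 ?_ ih
    simpa [hT.judgement_root] using (hP _ _ h).2.2
  | two h h₀ h₁ ih₀ ih₁ =>
    refine .two (hP _ _ h).1 ?_ ih₀ ih₁
    simpa [h₀.judgement_root, h₁.judgement_root] using (hP _ _ h).2.2

theorem Induces.append {P : List ProofLine} (Q : List ProofLine) {t : ℕ} {T : ProofTree}
    (h : Induces P t T) : Induces (P ++ Q) t T := by
  have key : ∀ {t : ℕ} {l : ProofLine}, P[t]? = some l → (P ++ Q)[t]? = some l := by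
    intro t l h
    rw [List.getElem?_append_left (List.getElem?_eq_some_iff.1 h).1, h]
  induction h with
  | leaf h => exact .leaf (key h)
  | one h _ ih => exact .one (key h) ih
  | two h _ _ ih₀ ih₁ => exact .two (key h) ih₀ ih₁

theorem IsClauseProof.concat {ψ : QCBF} {P : List ProofLine} (hP : IsClauseProof ψ P)
    {l : ProofLine} (hl : IsJudgement ψ l.judgement) (hp : ∀ p ∈ l.premises, p < P.length)
    (hd : Derives ψ (l.premises.filterMap fun p => P[p]?.map ProofLine.judgement) l.judgement) :
    IsClauseProof ψ (P ++ [l]) := by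
  have key : ∀ (ps : List ℕ), (∀ p ∈ ps, p < P.length) →
      (ps.filterMap fun p => (P ++ [l])[p]?.map ProofLine.judgement) =
        ps.filterMap fun p => P[p]?.map ProofLine.judgement := by
    intro ps h
    refine List.filterMap_congr fun p hp => ?_
    rw [List.getElem?_append_left (h p hp)]
  intro t m h
  rcases lt_or_ge t P.length with ht | ht
  · rw [List.getElem?_append_left ht] at h
    obtain ⟨h1, h2, h3⟩ := hP t m h
    exact ⟨h1, h2, by rwa [key _ fun p hp => (h2 p hp).trans ht]⟩
  · rw [List.getElem?_append_right ht] at h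
    obtain ⟨h0, h1⟩ := List.getElem?_eq_some_iff.1 h
    have h0' : t = P.length := by simp at h0; omega
    subst h0'
    simp only [Nat.sub_self, List.getElem_cons_zero] at h1
    subst h1
    exact ⟨hl, hp, by rwa [key _ hp]⟩

/-- The tree is written out after `P` in postorder, so that its root is the last line. The premises
used by a subtree lie in the block of lines of that subtree, below its root; different blocks are
disjoint, hence no line is used twice. `P` is arbitrary because the second subtree is appended after
the first. -/
theorem ValidTree.exists_append {ψ : QCBF} {T : ProofTree} (hT : ValidTree ψ T)
    {P : List ProofLine} (hP : IsClauseProof ψ P) :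
    ∃ (Q : List ProofLine) (t : ℕ), IsClauseProof ψ (P ++ Q) ∧ Induces (P ++ Q) t T ∧
      (Q.flatMap ProofLine.premises).Nodup ∧ P.length ≤ t ∧ t + 1 = (P ++ Q).length ∧
      ∀ p ∈ Q.flatMap ProofLine.premises, P.length ≤ p ∧ p < t := by
  induction hT generalizing P with
  | @leaf J hJ h =>
    exact ⟨[⟨J, []⟩], P.length, hP.concat hJ (by simp) (by simpa using h),
      .leaf (by simp), by simp, le_rfl, by simp, by simp⟩
  | @one J T hJ h hT ih =>
    obtain ⟨Q, t, h1, h2, h3, h4, h5, h6⟩ := ih hP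
    refine ⟨Q ++ [⟨J, [t]⟩], t + 1, ?_, ?_, ?_, by omega, ?_, ?_⟩
    · rw [← List.append_assoc]
      exact h1.concat hJ (by simp only [List.mem_singleton]; omega)
        (by simpa [h2.judgement_root] using h)
    · rw [← List.append_assoc]
      exact .one (by rw [h5]; simp) (h2.append _)
    · simp only [List.flatMap_append, List.flatMap_singleton]
      rw [List.nodup_append]
      refine ⟨h3, by simp, ?_⟩
      intro a ha b hb
      have := h6 a ha
      simp only [List.mem_singleton] at hb
      omega
    · simp only [List.length_append, List.length_singleton] at *; omega
    · intro p hp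
      simp only [List.flatMap_append, List.flatMap_singleton, List.mem_append,
        List.mem_singleton] at hp
      rcases hp with hp | hp
      · have := h6 p hp; omega
      · omega
  | @two J T₀ T₁ hJ h h₀ h₁ ih₀ ih₁ =>
    obtain ⟨Q, t, h1, h2, h3, h4, h5, h6⟩ := ih₀ hP
    obtain ⟨R, s, k1, k2, k3, k4, k5, k6⟩ := ih₁ h1
    have h2' := h2.append R
    refine ⟨Q ++ R ++ [⟨J, [t, s]⟩], s + 1, ?_, ?_, ?_, by omega, ?_, ?_⟩
    · rw [← List.append_assoc, ← List.append_assoc]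
      refine k1.concat hJ (fun p hp => ?_)
        (by
        simp only [List.filterMap_cons, List.filterMap_nil, h2'.judgement_root, k2.judgement_root]
        exact h)
      simp only [List.mem_cons, List.not_mem_nil, or_false] at hp
      omega
    · rw [← List.append_assoc, ← List.append_assoc]
      exact .two (by rw [k5]; simp) (h2'.append _) (k2.append _)
    · simp only [List.flatMap_append, List.flatMap_singleton]
      rw [List.nodup_append, List.nodup_append]
      refine ⟨⟨h3, k3, fun a ha b hb => ?_⟩, ?_, fun a ha b hb => ?_⟩
      · have := h6 a ha
        have := k6 b hb
        omega
      · simp; omega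
      · simp only [List.mem_cons, List.not_mem_nil, or_false] at hb
        rcases List.mem_append.1 ha with ha | ha
        · have := h6 a ha; omega
        · have := k6 a ha; omega
    · simp only [List.length_append, List.length_singleton] at *; omega
    · intro p hp
      simp only [List.flatMap_append, List.flatMap_singleton, List.mem_append,
        List.mem_cons, List.not_mem_nil, or_false] at hp
      rcases hp with (hp | hp) | hp
      · have := h6 p hp; omega
      · have := k6 p hp; omega
      · omega

/-- Reduces proofs to a local condition on trees. Equal subtrees may be written out several times,
so tree-likeness imposes nothing on the tree itself. -/
theorem isTreeRefutation_iff {ψ : QCBF} {T : ProofTree} :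
    IsTreeRefutation ψ T ↔ ValidTree ψ T ∧ T.root.clause.lits = ∅ := by
  refine and_congr_left fun _ => ⟨?_, fun h => ?_⟩
  · rintro ⟨P, t, hP, -, h⟩
    exact h.validTree hP
  · obtain ⟨Q, t, h1, h2, h3, -⟩ := h.exists_append (P := []) fun t l h => by simp at h
    exact ⟨Q, t, h1, h3, h2⟩

/-! ### Locations and free variables -/

theorem QCBF.at?_append (ψ : QCBF) (i j : Loc) :
    ψ.at? (i ++ j) = (ψ.at? i).bind fun φ => φ.at? j := by
  induction i generalizing ψ with
  | nil => cases ψ <;> rfl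
  | cons k i ih =>
    cases ψ with
    | clause C => rfl
    | conj n φ =>
      simp only [List.cons_append, QCBF.at?]
      split_ifs
      · exact ih _
      · rfl
    | all v φ =>
      simp only [List.cons_append, QCBF.at?]
      split_ifs
      · exact ih _
      · rfl
    | ex v φ =>
      simp only [List.cons_append, QCBF.at?]
      split_ifs
      · exact ih _
      · rfl

theorem QCBF.at?_nil (φ : QCBF) : φ.at? [] = some φ := by cases φ <;> rfl

theorem QCBF.exists_at?_of_prefix {ψ : QCBF} {i j : Loc} (h : i <+: j)
    (hj : ∃ φ, ψ.at? j = some φ) : ∃ φ, ψ.at? i = some φ := by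
  obtain ⟨s, rfl⟩ := h
  obtain ⟨φ, hφ⟩ := hj
  rw [QCBF.at?_append, Option.bind_eq_some_iff] at hφ
  exact ⟨_, hφ.choose_spec.1⟩

/-- The subformula at a location where `v` is quantified. -/
theorem IsLocated.exists_child {ψ : QCBF} {x : LocVar} (h : IsLocated ψ x) :
    ∃ θ φ : QCBF, ψ.at? x.1 = some θ ∧ θ.free = φ.free.erase x.2 ∧
      ∀ a, ψ.at? (x.1 ++ [a]) = if a = 0 then some φ else none := by
  rcases h with ⟨φ, h⟩ | ⟨φ, h⟩
  all_goals
    exact ⟨_, φ, h, rfl, fun a => by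
      rw [QCBF.at?_append, h]; simp [QCBF.at?, QCBF.at?_nil]⟩

theorem IsLocated.not_freeAt {ψ : QCBF} {x : LocVar} (h : IsLocated ψ x) :
    ¬ FreeAt ψ x.1 x.2 := by
  obtain ⟨θ, φ, h1, h2, -⟩ := h.exists_child
  rintro ⟨θ', h3, h4⟩
  rw [h1, Option.some.injEq] at h3
  subst h3
  simp [h2] at h4

theorem IsLocated.freeAt_child {ψ : QCBF} {x : LocVar} (h : IsLocated ψ x) {v : Var}
    (hv : FreeAt ψ x.1 v) : FreeAt ψ (x.1 ++ [0]) v := by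
  obtain ⟨θ, φ, h1, h2, h3⟩ := h.exists_child
  obtain ⟨θ', h4, h5⟩ := hv
  rw [h1, Option.some.injEq] at h4
  subst h4
  rw [h2] at h5
  exact ⟨φ, by simp [h3], Finset.mem_of_mem_erase h5⟩

theorem IsLocated.eq_of_loc_eq {ψ : QCBF} {x y : LocVar} (hx : IsLocated ψ x)
    (hy : IsLocated ψ y) (h : x.1 = y.1) : x = y := by
  refine Prod.ext h ?_
  rcases hx with ⟨φ, hx⟩ | ⟨φ, hx⟩ <;> rcases hy with ⟨φ', hy⟩ | ⟨φ', hy⟩ <;>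
    · rw [h, hy] at hx
      simp only [Option.some.injEq, QCBF.all.injEq, QCBF.ex.injEq, reduceCtorEq] at hx
      try exact hx.1.symm

theorem FreeAt.of_concat {ψ : QCBF} {i : Loc} {a : ℕ} {v : Var} (h : FreeAt ψ (i ++ [a]) v) :
    FreeAt ψ i v ∨ IsLocated ψ (i, v) := by
  obtain ⟨φ, h1, h2⟩ := h
  rw [QCBF.at?_append, Option.bind_eq_some_iff] at h1
  obtain ⟨θ, h3, h4⟩ := h1
  cases θ with
  | clause C => simp [QCBF.at?] at h4
  | conj n χ =>
    simp only [QCBF.at?, QCBF.at?_nil] at h4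
    split_ifs at h4 with ha
    rw [Option.some.injEq] at h4
    subst h4
    exact .inl ⟨_, h3, by simpa [QCBF.free] using ⟨_, h2⟩⟩
  | all u χ =>
    simp only [QCBF.at?, QCBF.at?_nil] at h4
    split_ifs at h4 with ha
    rw [Option.some.injEq] at h4
    subst h4
    by_cases hu : v = u
    · exact .inr (.inl ⟨_, hu ▸ h3⟩)
    · exact .inl ⟨_, h3, by simpa [QCBF.free] using ⟨hu, h2⟩⟩
  | ex u χ =>
    simp only [QCBF.at?, QCBF.at?_nil] at h4
    split_ifs at h4 with ha
    rw [Option.some.injEq] at h4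
    subst h4
    by_cases hu : v = u
    · exact .inr (.inr ⟨_, hu ▸ h3⟩)
    · exact .inl ⟨_, h3, by simpa [QCBF.free] using ⟨hu, h2⟩⟩

/-! ### Following located variables -/

theorem Follows.freeAt {ψ : QCBF} {j : Loc} {x : LocVar} (h : Follows ψ j x) : FreeAt ψ j x.2 :=
  h.2.2 j h.1 h.2.1 (List.prefix_refl j)

theorem Follows.length_lt {ψ : QCBF} {j : Loc} {x : LocVar} (h : Follows ψ j x) :
    x.1.length < j.length :=
  lt_of_le_of_ne h.1.length_le fun he => h.2.1 (h.1.eq_of_length he)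

theorem Follows.of_prefix {ψ : QCBF} {j p : Loc} {x : LocVar} (h : Follows ψ j x) (hp : p <+: j)
    (hl : x.1.length < p.length) : Follows ψ p x :=
  ⟨List.prefix_of_prefix_length_le h.1 hp hl.le, fun he => hl.ne (congrArg _ he),
    fun k h1 h2 h3 => h.2.2 k h1 h2 (h3.trans hp)⟩

theorem Follows.concat {ψ : QCBF} {j : Loc} {a : ℕ} {x : LocVar} (h : Follows ψ j x)
    (hf : FreeAt ψ (j ++ [a]) x.2) : Follows ψ (j ++ [a]) x := by
  refine ⟨h.1.trans (List.prefix_append _ _), fun he => ?_, fun k h1 h2 h3 => ?_⟩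
  · have := h.length_lt
    rw [he] at this
    simp at this
  · rcases List.prefix_concat_iff.1 h3 with rfl | h3
    · exact hf
    · exact h.2.2 k h1 h2 h3

theorem follows_concat_of_freeAt {ψ : QCBF} {x : LocVar} {a : ℕ}
    (hf : FreeAt ψ (x.1 ++ [a]) x.2) : Follows ψ (x.1 ++ [a]) x := by
  refine ⟨List.prefix_append _ _, by simp, fun k h1 h2 h3 => ?_⟩
  rcases List.prefix_concat_iff.1 h3 with rfl | h3
  · exact hf
  · exact absurd (h1.eq_of_length_le h3.length_le) h2

/-- Moving up from the child could fail only by arriving at the quantifier `x.1` itself, but `x.2`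
is free at `i` and not at `x.1`. This is why flow steps preserve binders. -/
theorem IsLocated.follows_concat_iff {ψ : QCBF} {x : LocVar} (hx : IsLocated ψ x) {i : Loc}
    {a : ℕ} (hi : FreeAt ψ i x.2) (hj : FreeAt ψ (i ++ [a]) x.2) :
    Follows ψ (i ++ [a]) x ↔ Follows ψ i x := by
  refine ⟨fun h => ?_, fun h => h.concat hj⟩
  have hl := h.length_lt
  refine h.of_prefix (List.prefix_append _ _) (lt_of_le_of_ne (by simp at hl; omega) fun he => ?_)
  have h1 := List.prefix_of_prefix_length_le h.1 (List.prefix_append i [a]) he.le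
  rw [← h1.eq_of_length he] at hi
  exact hx.not_freeAt hi

/-- A quantifier has the single child `0`, so every path strictly below it passes through that
child. -/
theorem IsLocated.concat_prefix {ψ : QCBF} {x : LocVar} (hx : IsLocated ψ x) {j : Loc}
    (h : Follows ψ j x) : x.1 ++ [0] <+: j := by
  obtain ⟨θ, φ, -, -, h3⟩ := hx.exists_child
  obtain ⟨s, hs⟩ := h.1
  cases s with
  | nil => exact absurd (by simpa using hs) h.2.1
  | cons a s =>
    have hp : x.1 ++ [a] <+: j := ⟨s, by rw [← hs]; simp⟩
    obtain ⟨χ, hχ⟩ := QCBF.exists_at?_of_prefix hp ⟨_, h.freeAt.choose_spec.1⟩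
    rw [h3] at hχ
    split_ifs at hχ with ha
    rwa [ha] at hp

/-- On the way up from `i` the variable must cease to be free, since nothing is free at the root,
and only a quantifier on it can cause that. -/
theorem exists_binder {ψ : QCBF} (hψ : ψ.IsInstance) {i : Loc} {v : Var} (h : FreeAt ψ i v) :
    ∃ k, IsLocated ψ (k, v) ∧ Follows ψ i (k, v) := by
  induction i using List.reverseRecOn with
  | nil =>
    obtain ⟨φ, h1, h2⟩ := h
    rw [QCBF.at?_nil, Option.some.injEq] at h1
    subst h1
    rw [hψ] at h2
    simp at h2
  | append_singleton i a ih =>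
    rcases h.of_concat with h' | h'
    · obtain ⟨k, hk, hf⟩ := ih h'
      exact ⟨k, hk, hf.concat h⟩
    · exact ⟨i, h', follows_concat_of_freeAt (x := (i, v)) h⟩

open Classical in
/-- The location of the quantifier that binds `v` at the location `i`. -/
noncomputable def binder (ψ : QCBF) (i : Loc) (v : Var) : Loc :=
  -- The longest prefix at which `v` is quantified. Including `i` itself is harmless when `v` is
  -- free at `i`, and in an instance the default `[]` is then not used.
  (i.inits.filter fun p => decide (IsLocated ψ (p, v))).reverse.headD []

theorem inits_concat (i : Loc) (a : ℕ) : (i ++ [a]).inits = i.inits ++ [i ++ [a]] := by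
  simp [List.inits_append]

theorem exists_inits_eq (i : Loc) :
    ∃ M : List Loc, i.inits = M ++ [i] ∧ ∀ p ∈ M, p.length < i.length := by
  rcases List.eq_nil_or_concat i with rfl | ⟨j, a, rfl⟩
  · exact ⟨[], rfl, by simp⟩
  · refine ⟨j.inits, by rw [List.concat_eq_append, inits_concat], fun p hp => ?_⟩
    have := ((List.mem_inits _ _).1 hp).length_le
    simp
    omega

theorem binder_of_located {ψ : QCBF} {i : Loc} {v : Var} (h : IsLocated ψ (i, v)) :
    binder ψ i v = i := by
  obtain ⟨M, hM, -⟩ := exists_inits_eq i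
  simp [binder, hM, List.filter_append, h]

theorem binder_concat {ψ : QCBF} {i : Loc} {a : ℕ} {v : Var} (h : FreeAt ψ (i ++ [a]) v) :
    binder ψ (i ++ [a]) v = binder ψ i v := by
  have : ¬ IsLocated ψ (i ++ [a], v) := fun hl => hl.not_freeAt h
  simp [binder, List.filter_append, this]

/-- Uniqueness of the binder: below `k` the variable stays free down to `i`, so no location in
between quantifies it again. -/
theorem binder_eq {ψ : QCBF} {i k : Loc} {v : Var} (hk : IsLocated ψ (k, v))
    (h : Follows ψ i (k, v)) : binder ψ i v = k := by
  induction i using List.reverseRecOn with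
  | nil => exact absurd h.length_lt (by simp)
  | append_singleton i a ih =>
    rw [binder_concat h.freeAt]
    by_cases hik : k = i
    · subst hik
      exact binder_of_located hk
    · have hp : k <+: i := (List.prefix_concat_iff.1 h.1).resolve_left h.2.1
      exact ih (h.of_prefix (List.prefix_append _ _)
        (lt_of_le_of_ne hp.length_le fun he => hik (hp.eq_of_length he)))

theorem binder_spec {ψ : QCBF} (hψ : ψ.IsInstance) {i : Loc} {v : Var} (h : FreeAt ψ i v) :
    IsLocated ψ (binder ψ i v, v) ∧ Follows ψ i (binder ψ i v, v) := by
  obtain ⟨k, h1, h2⟩ := exists_binder hψ h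
  rw [binder_eq h1 h2]
  exact ⟨h1, h2⟩

/-- The locations of the elements are prefixes of `j`, hence linearly ordered by length. The deeper
one inherits from `j` that it follows the other, and at equal length the two located variables
coincide. -/
theorem isCoherent_of_followsSet {ψ : QCBF} {S : Finset LocVar} {j : Loc}
    (hS : ∀ x ∈ S, IsLocated ψ x) (hj : FollowsSet ψ j S) : IsCoherent ψ S := by
  refine ⟨hS, fun x hx y hy hxy => ?_⟩
  have hfx := hj x hx
  have hfy := hj y hy
  rcases lt_trichotomy x.1.length y.1.length with h | h | h
  · exact .inr (hfx.of_prefix hfy.1 h)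
  · exact absurd ((hS x hx).eq_of_loc_eq (hS y hy)
      ((List.prefix_of_prefix_length_le hfx.1 hfy.1 h.le).eq_of_length h)) hxy
  · exact .inl (hfy.of_prefix hfx.1 h)

/-! ### From judgements to labels -/

theorem Clause.mem_vars {C : Clause} {v : Var} : v ∈ C.vars ↔ ∃ b, (v, b) ∈ C.lits := by
  simp [Clause.vars]

/-- The assignment that falsifies the clause, with the variables of the clause as domain. -/
def Clause.falsifier (C : Clause) : Assignment := fun v =>
  if (v, true) ∈ C.lits then some false else if (v, false) ∈ C.lits then some true else none

theorem Clause.falsifier_eq_some {C : Clause} {v : Var} {b : Bool} :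
    C.falsifier v = some b ↔ (v, !b) ∈ C.lits := by
  have := C.nontaut v
  cases b <;> simp only [Clause.falsifier, Bool.not_false, Bool.not_true] <;> split_ifs <;>
    simp_all

theorem Clause.falsifier_eq_none {C : Clause} {v : Var} :
    C.falsifier v = none ↔ v ∉ C.vars := by
  rw [Clause.mem_vars, Option.eq_none_iff_forall_not_mem]
  simp only [Option.mem_def, Clause.falsifier_eq_some, not_exists]
  exact ⟨fun h b => by simpa using h (!b), fun h b => h _⟩

/-- The label of the node of a trace that corresponds to a judgement. -/
noncomputable def Judgement.label (ψ : QCBF) (J : Judgement) : Label :=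
  ⟨J.clause.vars.image fun v => (binder ψ J.loc v, v), J.clause.falsifier⟩

theorem Judgement.varsOf_label {ψ : QCBF} {J : Judgement} :
    varsOf (J.label ψ).S = J.clause.vars := by
  simp [varsOf, Judgement.label, Finset.image_image, Function.comp_def]

theorem IsJudgement.freeAt {ψ : QCBF} {J : Judgement} (hJ : IsJudgement ψ J) {v : Var}
    (hv : v ∈ J.clause.vars) : FreeAt ψ J.loc v := by
  obtain ⟨φ, h1, h2⟩ := hJ
  exact ⟨φ, h1, h2 hv⟩

/-- Trades `binder` for `Follows`, in terms of which labels at neighbouring locations can be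
compared. -/
theorem IsJudgement.mem_label {ψ : QCBF} (hψ : ψ.IsInstance) {J : Judgement}
    (hJ : IsJudgement ψ J) {x : LocVar} :
    x ∈ (J.label ψ).S ↔ x.2 ∈ J.clause.vars ∧ IsLocated ψ x ∧ Follows ψ J.loc x := by
  simp only [Judgement.label, Finset.mem_image]
  constructor
  · rintro ⟨v, hv, rfl⟩
    exact ⟨hv, binder_spec hψ (hJ.freeAt hv)⟩
  · rintro ⟨h1, h2, h3⟩
    exact ⟨x.2, h1, Prod.ext (binder_eq h2 h3) rfl⟩

theorem IsJudgement.followsSet_label {ψ : QCBF} (hψ : ψ.IsInstance) {J : Judgement}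
    (hJ : IsJudgement ψ J) : FollowsSet ψ J.loc (J.label ψ).S :=
  fun _ hx => ((hJ.mem_label hψ).1 hx).2.2

theorem IsJudgement.isLabel {ψ : QCBF} (hψ : ψ.IsInstance) {J : Judgement}
    (hJ : IsJudgement ψ J) : IsLabel ψ (J.label ψ) := by
  refine ⟨isCoherent_of_followsSet (fun x hx => ((hJ.mem_label hψ).1 hx).2.1)
    (hJ.followsSet_label hψ), fun v => ?_⟩
  rw [Judgement.varsOf_label]
  exact Clause.falsifier_eq_none.not_left

theorem IsParent.label_eq {ψ : QCBF} (hψ : ψ.IsInstance) {i j : Loc} {α : Clause}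
    (h : IsParent i j) (hi : IsJudgement ψ ⟨i, α⟩) (hj : IsJudgement ψ ⟨j, α⟩) :
    Judgement.label ψ ⟨i, α⟩ = Judgement.label ψ ⟨j, α⟩ := by
  obtain ⟨k, rfl⟩ := h
  refine Label.ext ?_ rfl
  ext x
  rw [hi.mem_label hψ, hj.mem_label hψ]
  refine and_congr_right fun h1 => and_congr_right fun h2 => ?_
  exact (h2.follows_concat_iff (hi.freeAt h1) (hj.freeAt h1)).symm

theorem IsFlowStep.label_eq {ψ : QCBF} (hψ : ψ.IsInstance) {A J : Judgement}
    (h : IsFlowStep A J) (hA : IsJudgement ψ A) (hJ : IsJudgement ψ J) :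
    A.label ψ = J.label ψ := by
  obtain ⟨i, α⟩ := A
  obtain ⟨j, β⟩ := J
  obtain ⟨rfl : β = α, h | h⟩ := h
  · exact (h.label_eq hψ hJ hA).symm
  · exact h.label_eq hψ hA hJ

theorem Derives.of_singleton {ψ : QCBF} {A J : Judgement} (h : Derives ψ [A] J) :
    IsFlowStep A J ∨ ∃ y, IsAllLocated ψ (J.loc, y) ∧ IsParent J.loc A.loc ∧
      J.clause.lits = A.clause.lits \ {(y, true), (y, false)} := by
  cases h with
  | upwardFlow h => exact .inl ⟨rfl, .inl h⟩
  | downwardFlow h => exact .inl ⟨rfl, .inr h⟩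
  | allRemoval hi h hγ => exact .inr ⟨_, ⟨_, hi⟩, h, hγ⟩

/-- The only other unary rule shrinks the clause, so cardinalities decide. Unlike equality of
representations, this test does not depend on how the clauses are listed. -/
theorem Derives.isFlowStep_iff {ψ : QCBF} {A J : Judgement} (h : Derives ψ [A] J) :
    IsFlowStep A J ↔ J.clause.lits.card = A.clause.lits.card := by
  refine ⟨fun h => by rw [h.1], fun hc => ?_⟩
  rcases h.of_singleton with h | ⟨y, -, h2, h3⟩
  · exact h
  · refine ⟨Clause.ext ?_, .inl h2⟩
    exact Finset.eq_of_subset_of_card_le (h3 ▸ Finset.sdiff_subset) hc.ge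

/-- The removed variable is free at the child of `J.loc` and quantified at `J.loc`, so that is its
binder. All other variables are free at both locations and keep theirs. -/
theorem isAllBranch_label {ψ : QCBF} (hψ : ψ.IsInstance) {A J : Judgement} {y : Var}
    (hA : IsJudgement ψ A) (hJ : IsJudgement ψ J) (hy : IsAllLocated ψ (J.loc, y))
    (hp : IsParent J.loc A.loc) (hl : J.clause.lits = A.clause.lits \ {(y, true), (y, false)})
    (hne : J.clause.lits ≠ A.clause.lits) : IsAllBranch ψ (J.label ψ) (A.label ψ) := by
  obtain ⟨k, hk⟩ := hp
  have hmem : ∀ v b, (v, b) ∈ J.clause.lits ↔ (v, b) ∈ A.clause.lits ∧ v ≠ y := by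
    intro v b
    rw [hl]
    cases b <;> simp
  have hvars : ∀ v, v ∈ J.clause.vars ↔ v ∈ A.clause.vars ∧ v ≠ y := by
    intro v
    simp only [Clause.mem_vars, hmem, exists_and_right]
  -- Since the clauses differ, a literal on `y` was removed; `b` is the value that falsifies it.
  obtain ⟨b, hb⟩ : ∃ b, (y, !b) ∈ A.clause.lits := by
    by_contra! hcon
    apply hne
    ext ⟨v, b⟩
    rw [hmem]
    refine and_iff_left_of_imp fun h hv => ?_
    subst hv
    exact hcon (!b) (by simpa using h)
  have hyA : y ∈ A.clause.vars := Clause.mem_vars.2 ⟨_, hb⟩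
  have hyf : Follows ψ A.loc (J.loc, y) := by
    have := hA.freeAt hyA
    rw [hk] at this ⊢
    exact follows_concat_of_freeAt (x := (J.loc, y)) this
  refine ⟨(J.loc, y), b, hy, hJ.followsSet_label hψ, Label.ext ?_ ?_⟩
  · ext x
    rw [Finset.mem_insert, hA.mem_label hψ, hJ.mem_label hψ, hvars]
    constructor
    · rintro ⟨h1, h2, h3⟩
      by_cases hx : x.2 = y
      · subst hx
        exact .inl (Prod.ext ((binder_eq h2 h3).symm.trans (binder_eq (.inl hy) hyf)) rfl)
      · rw [hk] at h3
        have := (h2.follows_concat_iff (hJ.freeAt ((hvars _).2 ⟨h1, hx⟩))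
          (by rw [← hk]; exact hA.freeAt h1)).1 h3
        exact .inr ⟨⟨h1, hx⟩, h2, this⟩
    · rintro (rfl | ⟨⟨h1, hx⟩, h2, h3⟩)
      · exact ⟨hyA, .inl hy, hyf⟩
      · refine ⟨h1, h2, ?_⟩
        have := hA.freeAt h1
        rw [hk] at this ⊢
        exact h3.concat this
  · funext v
    change A.clause.falsifier v = Function.update J.clause.falsifier y (some b) v
    by_cases hv : v = y
    · subst hv
      rw [Function.update_self, Clause.falsifier_eq_some]
      exact hb
    · rw [Function.update_of_ne hv]
      refine Option.ext fun c => ?_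
      simp only [Clause.falsifier_eq_some, hmem]
      exact (and_iff_left hv).symm

theorem IsResolvent.symm_of_compl {γ α β : Clause} {L : Literal}
    (hγ : γ.lits = α.lits.erase L ∪ β.lits.erase L.compl) :
    γ.lits = β.lits.erase L.compl ∪ α.lits.erase L.compl.compl := by
  rw [hγ, Finset.union_comm]
  simp [Literal.compl]

/-- In a resolution step the literal resolved upon is unique. -/
theorem eq_of_resolvent {γ α β : Clause} {L M : Literal}
    (hγ : γ.lits = α.lits.erase L ∪ β.lits.erase L.compl) (hM : M ∈ α.lits)
    (hM' : M.compl ∈ β.lits) : M = L := by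
  by_contra hne
  have hne' : M.compl ≠ L.compl := fun h => hne <| by
    simpa [Literal.compl, Prod.ext_iff] using h
  -- A second clashing pair would survive in the resolvent and make it tautological.
  have h1 : M ∈ γ.lits := by rw [hγ]; simp [hne, hM]
  have h2 : M.compl ∈ γ.lits := by rw [hγ]; simp [hne', hM']
  obtain ⟨v, b⟩ := M
  cases b
  · exact γ.nontaut v ⟨h2, h1⟩
  · exact γ.nontaut v ⟨h1, h2⟩

/-- All three judgements share the location `i`, so a variable has the same binder in each, and `i`
follows every located variable involved, which gives coherence. The sets `S₀`, `S₁` are the labels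
of the premises without the one on `u`. The premise containing the positive literal is falsified by
`u → 0`, hence comes first. -/
theorem isQBranch_label {ψ : QCBF} (hψ : ψ.IsInstance) {i : Loc} {α β γ : Clause} {u : Var}
    (hα : IsJudgement ψ ⟨i, α⟩) (hβ : IsJudgement ψ ⟨i, β⟩) (hγ : IsJudgement ψ ⟨i, γ⟩)
    (hu : (u, true) ∈ α.lits) (hu' : (u, false) ∈ β.lits)
    (hl : γ.lits = α.lits.erase (u, true) ∪ β.lits.erase (u, false)) :
    IsQBranch ψ (Judgement.label ψ ⟨i, γ⟩) (Judgement.label ψ ⟨i, α⟩)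
      (Judgement.label ψ ⟨i, β⟩) := by
  have huα : u ∈ α.vars := Clause.mem_vars.2 ⟨_, hu⟩
  have huβ : u ∈ β.vars := Clause.mem_vars.2 ⟨_, hu'⟩
  -- Neither premise contains the other literal on `u`, so the resolvent has no literal on `u` at
  -- all.
  have hα' := α.nontaut u
  have hβ' := β.nontaut u
  have hmem : ∀ v b, (v, b) ∈ γ.lits ↔ ((v, b) ∈ α.lits ∨ (v, b) ∈ β.lits) ∧ v ≠ u := by
    intro v b
    rw [hl]
    by_cases hv : v = u
    · subst hv
      cases b <;> simp_all
    · simp [hv]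
  have hvars : ∀ v, v ∈ γ.vars ↔ (v ∈ α.vars ∨ v ∈ β.vars) ∧ v ≠ u := by
    intro v
    simp only [Clause.mem_vars, hmem, exists_and_right, exists_or]
  have hx := binder_spec hψ (hα.freeAt huα)
  have heq : ∀ x : LocVar, IsLocated ψ x → Follows ψ i x → x.2 = u → x = (binder ψ i u, u) := by
    rintro ⟨k, v⟩ h1 h2 rfl
    exact Prod.ext (binder_eq h1 h2).symm rfl
  have hunion : ((Judgement.label ψ ⟨i, α⟩).S.erase (binder ψ i u, u)) ∪
      ((Judgement.label ψ ⟨i, β⟩).S.erase (binder ψ i u, u)) = (Judgement.label ψ ⟨i, γ⟩).S := by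
    ext x
    simp only [Finset.mem_union, Finset.mem_erase, hα.mem_label hψ, hβ.mem_label hψ,
      hγ.mem_label hψ, hvars]
    constructor
    · rintro (⟨h1, h2, h3, h4⟩ | ⟨h1, h2, h3, h4⟩)
      · exact ⟨⟨.inl h2, fun h => h1 (heq x h3 h4 h)⟩, h3, h4⟩
      · exact ⟨⟨.inr h2, fun h => h1 (heq x h3 h4 h)⟩, h3, h4⟩
    · rintro ⟨⟨h1 | h1, h2⟩, h3, h4⟩
      · exact .inl ⟨fun h => h2 (h ▸ rfl), h1, h3, h4⟩
      · exact .inr ⟨fun h => h2 (h ▸ rfl), h1, h3, h4⟩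
  have hlabel : ∀ {δ : Clause} {b : Bool}, IsJudgement ψ ⟨i, δ⟩ → (u, !b) ∈ δ.lits →
      (∀ v b, (v, b) ∈ δ.lits → v ≠ u → (v, b) ∈ γ.lits) →
      Judgement.label ψ ⟨i, δ⟩ =
        ⟨insert (binder ψ i u, u) ((Judgement.label ψ ⟨i, δ⟩).S.erase (binder ψ i u, u)),
          ((Judgement.label ψ ⟨i, γ⟩).a.restrict (varsOf ((Judgement.label ψ ⟨i, δ⟩).S.erase
            (binder ψ i u, u)))).extend u b⟩ := by
    intro δ b hδ hb hδγ
    have huδ : u ∈ δ.vars := Clause.mem_vars.2 ⟨_, hb⟩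
    refine Label.ext ?_ ?_
    · refine (Finset.insert_erase ?_).symm
      exact (hδ.mem_label hψ).2 ⟨huδ, hx⟩
    · funext v
      change δ.falsifier v = Function.update (Assignment.restrict γ.falsifier _) u (some b) v
      by_cases hv : v = u
      · subst hv
        rw [Function.update_self, Clause.falsifier_eq_some]
        exact hb
      · rw [Function.update_of_ne hv, Assignment.restrict]
        have hvS : v ∈ varsOf ((Judgement.label ψ ⟨i, δ⟩).S.erase (binder ψ i u, u)) ↔
            v ∈ δ.vars := by
          simp only [varsOf, Finset.mem_image, Finset.mem_erase, hδ.mem_label hψ]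
          constructor
          · rintro ⟨x, ⟨-, h, -⟩, rfl⟩
            exact h
          · intro h
            exact ⟨(binder ψ i v, v), ⟨fun he => hv (congrArg Prod.snd he), h,
              binder_spec hψ (hδ.freeAt h)⟩, rfl⟩
        simp only [hvS]
        split_ifs with h
        · obtain ⟨c, hc⟩ := Clause.mem_vars.1 h
          have h1 : δ.falsifier v = some (!c) := Clause.falsifier_eq_some.2 (by simpa using hc)
          have h2 : γ.falsifier v = some (!c) :=
            Clause.falsifier_eq_some.2 (by simpa using hδγ v c hc hv)
          rw [h1, h2]
        · exact Clause.falsifier_eq_none.2 h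
  refine ⟨(binder ψ i u, u), _, _, hx.1, ?_, ?_, hunion, ?_, ?_⟩
  · rw [hγ.mem_label hψ, hvars]
    simp
  · refine isCoherent_of_followsSet (j := i) ?_ ?_
    · intro y hy
      rcases Finset.mem_insert.1 hy with rfl | hy
      · exact hx.1
      · exact ((hγ.mem_label hψ).1 hy).2.1
    · intro y hy
      rcases Finset.mem_insert.1 hy with rfl | hy
      · exact hx.2
      · exact ((hγ.mem_label hψ).1 hy).2.2
  · exact hlabel hα hu fun v b h hv => (hmem v b).2 ⟨.inl h, hv⟩
  · exact hlabel hβ hu' fun v b h hv => (hmem v b).2 ⟨.inr h, hv⟩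

/-! ### From proofs to traces -/

open Classical in
/-- The trace of a tree of judgements. -/
noncomputable def ProofTree.toTrace (ψ : QCBF) : ProofTree → TraceTree
  | .leaf J => .leaf (J.label ψ) J.loc
  | .one J T =>
    -- In a valid tree this detects exactly the flow steps, which leave no node in the trace.
    if J.clause.lits.card = T.root.clause.lits.card then T.toTrace ψ
    else .one (J.label ψ) (T.toTrace ψ)
  | .two J T₀ T₁ =>
    -- The branch `u → 0` is listed first; it belongs to the premise with the positive literal.
    if ∃ v, (v, true) ∈ T₀.root.clause.lits ∧ (v, false) ∈ T₁.root.clause.lits then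
      .two (J.label ψ) (T₀.toTrace ψ) (T₁.toTrace ψ)
    else .two (J.label ψ) (T₁.toTrace ψ) (T₀.toTrace ψ)

theorem ValidTree.toTrace_spec {ψ : QCBF} (hψ : ψ.IsInstance) {T : ProofTree}
    (h : ValidTree ψ T) : IsTrace ψ (T.toTrace ψ) ∧ (T.toTrace ψ).root = T.root.label ψ ∧
      (T.toTrace ψ).numNodes = T.nonFlow := by
  induction h with
  | @leaf J hJ h =>
    refine ⟨.leaf (hJ.isLabel hψ) ?_, rfl, rfl⟩
    cases h with
    | @clause i α hα =>
      refine ⟨α, hα, hJ.followsSet_label hψ, fun L hL => ?_,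
        (Judgement.varsOf_label (J := ⟨i, α⟩)).symm⟩
      exact Clause.falsifier_eq_some.2 (by simpa using hL)
  | @one J T hJ h hT ih =>
    obtain ⟨h1, h2, h3⟩ := ih
    have hiff := h.isFlowStep_iff
    simp only [ProofTree.toTrace, ProofTree.nonFlow]
    by_cases hc : J.clause.lits.card = T.root.clause.lits.card
    · rw [if_pos hc, if_pos (hiff.2 hc)]
      exact ⟨h1, h2.trans ((hiff.2 hc).label_eq hψ hT.isJudgement hJ), h3⟩
    · rw [if_neg hc, if_neg (mt hiff.1 hc)]
      refine ⟨.one (hJ.isLabel hψ) ?_ h1, rfl, by rw [TraceTree.numNodes, h3]⟩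
      rw [h2]
      rcases h.of_singleton with hf | ⟨y, hy, hp, hl⟩
      · exact absurd (hiff.1 hf) hc
      · exact isAllBranch_label hψ hT.isJudgement hJ hy hp hl fun he => hc (by rw [he])
  | @two J T₀ T₁ hJ h hT₀ hT₁ ih₀ ih₁ =>
    obtain ⟨h1, h2, h3⟩ := ih₀
    obtain ⟨k1, k2, k3⟩ := ih₁
    have hJ₀ := hT₀.isJudgement
    have hJ₁ := hT₁.isJudgement
    simp only [ProofTree.toTrace, ProofTree.nonFlow]
    generalize T₀.root = A at *
    generalize T₁.root = B at *
    cases h with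
    | @resolve i α β γ h =>
      obtain ⟨⟨u, b⟩, hα, hβ, hγ⟩ := h
      cases b with
      | true =>
        rw [if_pos ⟨u, hα, hβ⟩]
        refine ⟨.two (hJ.isLabel hψ) ?_ h1 k1, rfl, by rw [TraceTree.numNodes, h3, k3]⟩
        rw [h2, k2]
        exact isQBranch_label hψ hJ₀ hJ₁ hJ hα hβ hγ
      | false =>
        rw [if_neg]
        · refine ⟨.two (hJ.isLabel hψ) ?_ k1 h1, rfl, by rw [TraceTree.numNodes, h3, k3]; omega⟩
          rw [h2, k2]
          exact isQBranch_label hψ hJ₁ hJ₀ hJ hβ hα (IsResolvent.symm_of_compl hγ)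
        -- The literal resolved upon is unique and negative here, so no positive literal of the
        -- first premise clashes.
        · rintro ⟨v, hv, hv'⟩
          have := eq_of_resolvent hγ hv hv'
          simp at this

theorem IsTreeRefutation.toTrace_spec {ψ : QCBF} (hψ : ψ.IsInstance) {T : ProofTree}
    (h : IsTreeRefutation ψ T) :
    IsRootTrace ψ (T.toTrace ψ) ∧ (T.toTrace ψ).numNodes = T.nonFlow := by
  obtain ⟨hT, he⟩ := isTreeRefutation_iff.1 h
  obtain ⟨h1, h2, h3⟩ := hT.toTrace_spec hψ
  refine ⟨⟨h1, h2.trans ?_⟩, h3⟩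
  refine Label.ext (by simp [Judgement.label, Label.init, Clause.vars, he]) (funext fun v => ?_)
  simp [Judgement.label, Label.init, Clause.falsifier, he]

/-! ### From traces to proofs -/

/-- The clause falsified by the assignment of a label. -/
def Label.clause (l : Label) : Clause where
  lits := (varsOf l.S ×ˢ Finset.univ).filter fun L => l.a L.1 = some (!L.2)
  nontaut v h := by
    simp only [Finset.mem_filter] at h
    rw [h.1.2] at h
    simp at h

theorem IsLabel.mem_clause {ψ : QCBF} {l : Label} (hl : IsLabel ψ l) {v : Var} {b : Bool} :
    (v, b) ∈ l.clause.lits ↔ l.a v = some (!b) := by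
  simp only [Label.clause, Finset.mem_filter, Finset.mem_product, Finset.mem_univ, and_true]
  exact and_iff_right_of_imp fun h => (hl.2 v).1 (by simp [h])

theorem IsLabel.vars_clause {ψ : QCBF} {l : Label} (hl : IsLabel ψ l) :
    l.clause.vars = varsOf l.S := by
  ext v
  rw [Clause.mem_vars, ← hl.2 v, Option.ne_none_iff_exists']
  simp only [hl.mem_clause]
  exact ⟨fun ⟨b, h⟩ => ⟨_, h⟩, fun ⟨b, h⟩ => ⟨!b, by simpa using h⟩⟩

/-! ### Top locations of coherent sets -/

open Classical in
/-- The deepest location of a set of located variables. -/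
noncomputable def deepest (S : Finset LocVar) : Loc :=
  if h : S.Nonempty then (S.exists_max_image (fun x => x.1.length) h).choose.1 else []

open Classical in
/-- The topmost location that follows a set of located variables. -/
noncomputable def topLoc (S : Finset LocVar) : Loc := if S.Nonempty then deepest S ++ [0] else []

theorem exists_eq_deepest {S : Finset LocVar} (h : S.Nonempty) :
    ∃ x ∈ S, (∀ y ∈ S, y.1.length ≤ x.1.length) ∧ deepest S = x.1 := by
  have hs := (S.exists_max_image (fun x => x.1.length) h).choose_spec
  exact ⟨_, hs.1, hs.2, by rw [deepest, dif_pos h]⟩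

theorem topLoc_of_nonempty {S : Finset LocVar} (h : S.Nonempty) : topLoc S = deepest S ++ [0] :=
  if_pos h

theorem topLoc_empty : topLoc ∅ = [] := if_neg (by simp)

/-- Following strictly increases depth, so a coherent set has only one element of maximal depth and
the choice made in `deepest` is immaterial. -/
theorem IsCoherent.deepest_eq {ψ : QCBF} {S : Finset LocVar} (hS : IsCoherent ψ S) {x : LocVar}
    (hx : x ∈ S) (hmax : ∀ y ∈ S, y.1.length ≤ x.1.length) : deepest S = x.1 := by
  obtain ⟨y, hy, hymax, h⟩ := exists_eq_deepest ⟨x, hx⟩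
  rw [h]
  by_contra hne
  have hxy : x ≠ y := fun h => hne (h ▸ rfl)
  rcases hS.2 x hx y hy hxy with hf | hf
  · exact absurd (hymax x hx) (not_le.2 hf.length_lt)
  · exact absurd (hmax y hy) (not_le.2 hf.length_lt)

/-- The location exists and follows the set. -/
def Supports (ψ : QCBF) (j : Loc) (S : Finset LocVar) : Prop :=
  (∃ φ, ψ.at? j = some φ) ∧ FollowsSet ψ j S

theorem Supports.topLoc_prefix {ψ : QCBF} {j : Loc} {S : Finset LocVar} (h : Supports ψ j S)
    (hS : IsCoherent ψ S) : topLoc S <+: j := by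
  rcases S.eq_empty_or_nonempty with rfl | hne
  · rw [topLoc_empty]
    exact List.nil_prefix
  · obtain ⟨x, hx, -, hd⟩ := exists_eq_deepest hne
    rw [topLoc_of_nonempty hne, hd]
    exact (hS.1 x hx).concat_prefix (h.2 x hx)

/-- From `topLoc S` on, a prefix of `j` is strictly deeper than every element of `S`, which is all
that a prefix needs in order to follow `S`. So a clause can flow along the whole path. -/
theorem Supports.of_prefix {ψ : QCBF} {j p : Loc} {S : Finset LocVar} (h : Supports ψ j S)
    (hp : topLoc S <+: p) (hj : p <+: j) : Supports ψ p S := by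
  refine ⟨QCBF.exists_at?_of_prefix hj h.1, fun y hy => (h.2 y hy).of_prefix hj ?_⟩
  obtain ⟨x, hx, hmax, hd⟩ := exists_eq_deepest ⟨y, hy⟩
  rw [topLoc_of_nonempty ⟨y, hy⟩, hd] at hp
  have h1 := hp.length_le
  have h2 := hmax y hy
  simp only [List.length_append, List.length_singleton] at h1
  omega

theorem IsLabel.isJudgement {ψ : QCBF} {l : Label} (hl : IsLabel ψ l) {j : Loc}
    (h : Supports ψ j l.S) : IsJudgement ψ ⟨j, l.clause⟩ := by
  obtain ⟨⟨φ, hφ⟩, hf⟩ := h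
  refine ⟨φ, hφ, ?_⟩
  change l.clause.vars ⊆ _
  rw [hl.vars_clause]
  intro v hv
  obtain ⟨x, hx, rfl⟩ := Finset.mem_image.1 hv
  obtain ⟨χ, h1, h2⟩ := (hf x hx).freeAt
  rw [hφ, Option.some.injEq] at h1
  rwa [h1]

/-! ### Chains of flow steps -/

/-- The proper prefixes of `i` from the length of `k` on. -/
def upLocs (i k : Loc) : List Loc :=
  i.inits.filter fun p => decide (k.length ≤ p.length) && decide (p.length < i.length)

/-- The prefixes of `j` that are longer than `k`, the longest first. -/
def downLocs (k j : Loc) : List Loc :=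
  (j.inits.filter fun p => decide (k.length < p.length)).reverse

theorem upLocs_self (k : Loc) : upLocs k k = [] := by
  simp only [upLocs, List.filter_eq_nil_iff]
  intro p _
  simp

theorem upLocs_concat {i k : Loc} {a : ℕ} (h : k.length ≤ i.length) :
    upLocs (i ++ [a]) k = upLocs i k ++ [i] := by
  obtain ⟨M, hM, hlt⟩ := exists_inits_eq i
  simp only [upLocs, inits_concat, hM, List.filter_append]
  simp only [List.length_append, List.length_singleton, List.filter_cons, List.filter_nil]
  have : M.filter (fun p => decide (k.length ≤ p.length) && decide (p.length < i.length + 1)) =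
      M.filter (fun p => decide (k.length ≤ p.length) && decide (p.length < i.length)) := by
    refine List.filter_congr fun p hp => ?_
    have := hlt p hp
    simp [this, this.trans (Nat.lt_succ_self _)]
  rw [this]
  simp [h]

theorem downLocs_self (k : Loc) : downLocs k k = [] := by
  simp only [downLocs, List.reverse_eq_nil_iff, List.filter_eq_nil_iff]
  intro p hp
  have := ((List.mem_inits _ _).1 hp).length_le
  simpa using this

theorem downLocs_concat {k j : Loc} {a : ℕ} (h : k.length ≤ j.length) :
    downLocs k (j ++ [a]) = (j ++ [a]) :: downLocs k j := by
  simp only [downLocs, inits_concat, List.filter_append, List.reverse_append]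
  simp [show k.length < j.length + 1 by omega]

/-- A chain of flow steps at the given locations, the last one first. -/
def ProofTree.chain (C : Clause) (T : ProofTree) (ls : List Loc) : ProofTree :=
  ls.foldr (fun k T => .one ⟨k, C⟩ T) T

/-- The induction peels off the lower end of the path: the first upward step is absorbed into the
tree, which therefore has to be arbitrary. -/
theorem ProofTree.chain_upLocs {ψ : QCBF} {C : Clause} {k i : Loc} (hki : k <+: i)
    (hJ : ∀ p, k <+: p → p <+: i → IsJudgement ψ ⟨p, C⟩) {T : ProofTree} (hT : ValidTree ψ T)
    (hr : T.root = ⟨i, C⟩) : ValidTree ψ (chain C T (upLocs i k)) ∧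
      (chain C T (upLocs i k)).root = ⟨k, C⟩ ∧ (chain C T (upLocs i k)).nonFlow = T.nonFlow := by
  obtain ⟨s, rfl⟩ := hki
  induction s using List.reverseRecOn generalizing T with
  | nil =>
    rw [List.append_nil] at *
    rw [upLocs_self]
    exact ⟨hT, hr, rfl⟩
  | append_singleton s a ih =>
    rw [← List.append_assoc] at hr hJ ⊢
    rw [upLocs_concat (by simp), chain, List.foldr_append]
    have hp : IsParent (k ++ s) (k ++ s ++ [a]) := ⟨a, rfl⟩
    obtain ⟨h1, h2, h3⟩ := ih (T := .one ⟨k ++ s, C⟩ T)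
      (hJ := fun p h h' => hJ p h (h'.trans (List.prefix_append _ _)))
      (hT := .one (hJ _ (List.prefix_append _ _) (List.prefix_append _ _))
        (by rw [hr]; exact .upwardFlow hp) hT) (hr := rfl)
    refine ⟨h1, h2, h3.trans ?_⟩
    rw [ProofTree.nonFlow, hr, if_pos ⟨rfl, .inl hp⟩, add_zero]

theorem ProofTree.chain_downLocs {ψ : QCBF} {C : Clause} {k j : Loc} (hkj : k <+: j)
    (hJ : ∀ p, k <+: p → p <+: j → IsJudgement ψ ⟨p, C⟩) {T : ProofTree} (hT : ValidTree ψ T)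
    (hr : T.root = ⟨k, C⟩) : ValidTree ψ (chain C T (downLocs k j)) ∧
      (chain C T (downLocs k j)).root = ⟨j, C⟩ ∧
      (chain C T (downLocs k j)).nonFlow = T.nonFlow := by
  obtain ⟨s, rfl⟩ := hkj
  induction s using List.reverseRecOn with
  | nil =>
    rw [List.append_nil, downLocs_self]
    exact ⟨hT, hr, rfl⟩
  | append_singleton s a ih =>
    rw [← List.append_assoc] at hJ ⊢
    rw [downLocs_concat (by simp), chain, List.foldr_cons]
    have hp : IsParent (k ++ s) (k ++ s ++ [a]) := ⟨a, rfl⟩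
    obtain ⟨h1, h2, h3⟩ := ih fun p h h' => hJ p h (h'.trans (List.prefix_append _ _))
    rw [chain] at h1 h2 h3
    refine ⟨.one (hJ _ (by simp [List.append_assoc]) List.prefix_rfl)
      (by rw [h2]; exact .downwardFlow hp) h1, rfl, ?_⟩
    rw [ProofTree.nonFlow, h2, h3, if_pos ⟨rfl, .inr hp⟩, add_zero]

/-- The longer one of two lists. -/
def longer (i j : Loc) : Loc := if i.length ≤ j.length then j else i

/-- The tree of judgements of a trace. -/
noncomputable def TraceTree.toProof : TraceTree → ProofTree
  | .leaf l i => .chain l.clause (.leaf ⟨i, l.clause⟩) (upLocs i (topLoc l.S))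
  | .one l T =>
    -- The new ∀-located variable follows all of `l.S`, so its quantifier is at the deepest location
    -- of the child's set.
    .chain l.clause (.one ⟨deepest T.root.S, l.clause⟩ T.toProof)
      (upLocs (deepest T.root.S) (topLoc l.S))
  | .two l T₀ T₁ =>
    .chain l.clause
      (.two ⟨longer (topLoc T₀.root.S) (topLoc T₁.root.S), l.clause⟩
        (.chain T₀.root.clause T₀.toProof
          (downLocs (topLoc T₀.root.S) (longer (topLoc T₀.root.S) (topLoc T₁.root.S))))
        (.chain T₁.root.clause T₁.toProof
          (downLocs (topLoc T₁.root.S) (longer (topLoc T₀.root.S) (topLoc T₁.root.S)))))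
      (upLocs (longer (topLoc T₀.root.S) (topLoc T₁.root.S)) (topLoc l.S))

theorem IsTrace.isLabel {ψ : QCBF} {T : TraceTree} (h : IsTrace ψ T) : IsLabel ψ T.root := by
  cases h <;> assumption

theorem IsLabel.chain_upLocs {ψ : QCBF} {l : Label} (hl : IsLabel ψ l) {i : Loc}
    (hi : Supports ψ i l.S) {T : ProofTree} (hT : ValidTree ψ T) (hr : T.root = ⟨i, l.clause⟩) :
    ValidTree ψ (.chain l.clause T (upLocs i (topLoc l.S))) ∧
      (ProofTree.chain l.clause T (upLocs i (topLoc l.S))).root = ⟨topLoc l.S, l.clause⟩ ∧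
      (ProofTree.chain l.clause T (upLocs i (topLoc l.S))).nonFlow = T.nonFlow :=
  ProofTree.chain_upLocs (hi.topLoc_prefix hl.1)
    (fun _ h1 h2 => hl.isJudgement (hi.of_prefix h1 h2)) hT hr

theorem IsLabel.chain_downLocs {ψ : QCBF} {l : Label} (hl : IsLabel ψ l) {j : Loc}
    (hj : Supports ψ j l.S) {T : ProofTree} (hT : ValidTree ψ T)
    (hr : T.root = ⟨topLoc l.S, l.clause⟩) :
    ValidTree ψ (.chain l.clause T (downLocs (topLoc l.S) j)) ∧
      (ProofTree.chain l.clause T (downLocs (topLoc l.S) j)).root = ⟨j, l.clause⟩ ∧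
      (ProofTree.chain l.clause T (downLocs (topLoc l.S) j)).nonFlow = T.nonFlow :=
  ProofTree.chain_downLocs (hj.topLoc_prefix hl.1)
    (fun _ h1 h2 => hl.isJudgement (hj.of_prefix h1 h2)) hT hr

theorem Supports.topLoc {ψ : QCBF} {j : Loc} {S : Finset LocVar} (h : Supports ψ j S)
    (hS : IsCoherent ψ S) : Supports ψ (QCBFTrace.topLoc S) S :=
  h.of_prefix List.prefix_rfl (h.topLoc_prefix hS)

/-- The topmost location that follows one part of a coherent set follows any other part whose
topmost location is not deeper. -/
theorem IsCoherent.supports_of_length_le {ψ : QCBF} {S S₀ S₁ : Finset LocVar}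
    (hS : IsCoherent ψ S) (h₀ : S₀ ⊆ S) (h₁ : S₁ ⊆ S) (hne₀ : S₀.Nonempty) (hne₁ : S₁.Nonempty)
    (hs : Supports ψ (topLoc S₁) S₁) (hle : (topLoc S₀).length ≤ (topLoc S₁).length) :
    Supports ψ (topLoc S₁) S₀ := by
  refine ⟨hs.1, fun y hy => ?_⟩
  obtain ⟨x, hx, -, hd⟩ := exists_eq_deepest hne₁
  obtain ⟨z, hz, hmax, hd'⟩ := exists_eq_deepest hne₀
  rw [topLoc_of_nonempty hne₀, topLoc_of_nonempty hne₁, hd, hd'] at hle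
  simp only [List.length_append, List.length_singleton] at hle
  rw [topLoc_of_nonempty hne₁, hd] at hs ⊢
  by_cases hyx : y = x
  · exact hyx ▸ hs.2 x hx
  -- `y` cannot follow `x`, as it would then be deeper than `x`, which is at least as deep as all of
  -- `S₀`. So `x` follows `y`, and a variable free at the quantifier `x.1` is still free at its
  -- child.
  rcases hS.2 y (h₀ hy) x (h₁ hx) hyx with h | h
  · have := h.length_lt
    have := hmax y hy
    omega
  · exact h.concat ((hS.1 x (h₁ hx)).freeAt_child h.freeAt)

/-- The invariant places every derived judgement at the top location of its label. That this
location supports the label is part of the induction, since it supplies the meeting point at a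
Q-branch. -/
theorem IsTrace.toProof_spec {ψ : QCBF} {T : TraceTree} (h : IsTrace ψ T) :
    ValidTree ψ T.toProof ∧ T.toProof.root = ⟨topLoc T.root.S, T.root.clause⟩ ∧
      Supports ψ (topLoc T.root.S) T.root.S ∧ T.toProof.nonFlow = T.numNodes := by
  induction h with
  | @leaf l i hl h =>
    obtain ⟨C, hC, hf, hfal, hv⟩ := h
    -- A falsified clause is determined by its variables and the assignment.
    have hCl : C = l.clause := by
      refine Clause.ext (Finset.ext fun ⟨v, b⟩ => ?_)
      rw [hl.mem_clause]
      refine ⟨hfal _, fun h => ?_⟩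
      have : v ∈ C.vars := by rw [hv, ← hl.2 v, h]; simp
      obtain ⟨c, hc⟩ := Clause.mem_vars.1 this
      have := (hfal _ hc).symm.trans h
      simp only [Option.some.injEq, Bool.not_eq_eq_eq_not, Bool.not_not] at this
      rwa [← this]
    subst hCl
    have hs : Supports ψ i l.S := ⟨⟨_, hC⟩, hf⟩
    obtain ⟨h1, h2, h3⟩ := hl.chain_upLocs hs (T := .leaf ⟨i, l.clause⟩)
      (.leaf (hl.isJudgement hs) (.clause hC)) rfl
    exact ⟨h1, h2, hs.topLoc hl.1, h3⟩
  | @one l T hl h hT ih =>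
    obtain ⟨h1, h2, h3, h4⟩ := ih
    have hl' := hT.isLabel
    obtain ⟨⟨k, y⟩, b, ⟨φ, hφ⟩, hf, hT'⟩ := h
    have hk : IsLocated ψ (k, y) := .inl ⟨φ, hφ⟩
    have hS : T.root.S = insert (k, y) l.S := by rw [hT']
    have ha : T.root.a = l.a.extend y b := by rw [hT']
    have hne : T.root.S.Nonempty := ⟨(k, y), by simp [hS]⟩
    have hd : deepest T.root.S = k := by
      refine hl'.1.deepest_eq (x := (k, y)) (by simp [hS]) fun z hz => ?_
      rw [hS, Finset.mem_insert] at hz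
      rcases hz with rfl | hz
      · exact le_rfl
      · exact (hf z hz).length_lt.le
    have hs : Supports ψ k l.S := ⟨⟨_, hφ⟩, hf⟩
    have hy : y ∉ varsOf l.S := by
      intro hy
      obtain ⟨z, hz, rfl⟩ := Finset.mem_image.1 hy
      exact hk.not_freeAt (hf z hz).freeAt
    have hlits : l.clause.lits = T.root.clause.lits \ {(y, true), (y, false)} := by
      ext ⟨v, c⟩
      rw [Finset.mem_sdiff, hl.mem_clause, hl'.mem_clause, ha]
      by_cases hv : v = y
      · subst hv
        have : l.a v = none := by
          by_contra hcon
          exact hy ((hl.2 v).1 hcon)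
        cases c <;> simp [this]
      · simp [Assignment.extend, hv]
    -- A literal on `y` really is removed, so this ∀-removal counts as a non-flow judgement.
    have hneq : l.clause ≠ T.root.clause := by
      intro he
      have h : (y, !b) ∈ T.root.clause.lits := by
        rw [hl'.mem_clause, ha]
        simp [Assignment.extend]
      rw [← he, hlits] at h
      cases b <;> simp at h
    -- The premise is already at the child of the quantifier; no downward flow is needed.
    have hp : IsParent k (topLoc T.root.S) := ⟨0, by rw [topLoc_of_nonempty hne, hd]⟩
    obtain ⟨k1, k2, k3⟩ := hl.chain_upLocs hs (T := .one ⟨k, l.clause⟩ T.toProof)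
      (.one (hl.isJudgement hs) (by rw [h2]; exact .allRemoval hφ hp hlits) h1) rfl
    simp only [TraceTree.toProof, hd]
    refine ⟨k1, k2, hs.topLoc hl.1, k3.trans ?_⟩
    rw [ProofTree.nonFlow, h2, if_neg fun hflow => hneq hflow.1, h4, TraceTree.numNodes]
  | @two l T₀ T₁ hl h hT₀ hT₁ ih₀ ih₁ =>
    obtain ⟨h1, h2, h3, h4⟩ := ih₀
    obtain ⟨k1, k2, k3, k4⟩ := ih₁
    have hl₀ := hT₀.isLabel
    have hl₁ := hT₁.isLabel
    obtain ⟨⟨k, u⟩, S₀, S₁, hu, huS, hcoh, hunion, e₀, e₁⟩ := h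
    have hS₀ : T₀.root.S = insert (k, u) S₀ := by rw [e₀]
    have hS₁ : T₁.root.S = insert (k, u) S₁ := by rw [e₁]
    have ha₀ : T₀.root.a = (l.a.restrict (varsOf S₀)).extend u false := by rw [e₀]
    have ha₁ : T₁.root.a = (l.a.restrict (varsOf S₁)).extend u true := by rw [e₁]
    have hne₀ : T₀.root.S.Nonempty := ⟨(k, u), by simp [hS₀]⟩
    have hne₁ : T₁.root.S.Nonempty := ⟨(k, u), by simp [hS₁]⟩
    have hsub₀ : T₀.root.S ⊆ insert (k, u) l.S := by
      rw [hS₀, ← hunion]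
      exact Finset.insert_subset_insert _ Finset.subset_union_left
    have hsub₁ : T₁.root.S ⊆ insert (k, u) l.S := by
      rw [hS₁, ← hunion]
      exact Finset.insert_subset_insert _ Finset.subset_union_right
    obtain ⟨j, hj⟩ : ∃ j, j = longer (topLoc T₀.root.S) (topLoc T₁.root.S) := ⟨_, rfl⟩
    have hs : Supports ψ j T₀.root.S ∧ Supports ψ j T₁.root.S := by
      rw [hj, longer]
      split_ifs with hle
      · exact ⟨hcoh.supports_of_length_le hsub₀ hsub₁ hne₀ hne₁ k3 hle, k3⟩
      · exact ⟨h3, hcoh.supports_of_length_le hsub₁ hsub₀ hne₁ hne₀ h3 (not_le.1 hle).le⟩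
    have hsl : Supports ψ j l.S := by
      refine ⟨hs.1.1, fun x hx => ?_⟩
      rw [← hunion, Finset.mem_union] at hx
      rcases hx with hx | hx
      · exact hs.1.2 x (by simp [hS₀, hx])
      · exact hs.2.2 x (by simp [hS₁, hx])
    -- A coherent set has no two elements on one variable: the variable is not free at the lower
    -- quantifier, which therefore cannot follow the upper one.
    have huv : u ∉ varsOf l.S := by
      intro hmem
      obtain ⟨⟨k', u'⟩, hz, rfl⟩ := Finset.mem_image.1 hmem
      have hloc := hcoh.1 _ (Finset.mem_insert_of_mem hz)
      have hne : ((k, u') : LocVar) ≠ (k', u') := fun he => huS (he ▸ hz)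
      rcases hcoh.2 _ (Finset.mem_insert_self _ _) _ (Finset.mem_insert_of_mem hz) hne
        with hf | hf
      · exact hu.not_freeAt hf.freeAt
      · exact hloc.not_freeAt hf.freeAt
    have hlu : l.a u = none := by
      by_contra hcon
      exact huv ((hl.2 u).1 hcon)
    have hlits : l.clause.lits =
        T₀.root.clause.lits.erase (u, true) ∪ T₁.root.clause.lits.erase (u, false) := by
      ext ⟨v, c⟩
      rw [Finset.mem_union, Finset.mem_erase, Finset.mem_erase, hl.mem_clause, hl₀.mem_clause,
        hl₁.mem_clause, ha₀, ha₁]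
      by_cases hv : v = u
      · subst hv
        cases c <;> simp [hlu, Assignment.extend]
      -- As `S₀ ∪ S₁ = l.S`, every value of `l.a` survives in at least one of the two restrictions.
      · have hdom : l.a v = some (!c) → v ∈ varsOf S₀ ∨ v ∈ varsOf S₁ := by
          intro h
          have := (hl.2 v).1 (by simp [h])
          rwa [← hunion, varsOf, Finset.image_union, Finset.mem_union] at this
        simp only [Assignment.extend, Function.update_of_ne hv, Assignment.restrict]
        by_cases hv₀ : v ∈ varsOf S₀ <;> by_cases hv₁ : v ∈ varsOf S₁ <;> simp_all
    have hres : IsResolvent l.clause T₀.root.clause T₁.root.clause := by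
      refine ⟨(u, true), ?_, ?_, hlits⟩
      · rw [hl₀.mem_clause, ha₀]
        simp [Assignment.extend]
      · change (u, false) ∈ _
        rw [hl₁.mem_clause, ha₁]
        simp [Assignment.extend]
    obtain ⟨c1, c2, c3⟩ := hl₀.chain_downLocs hs.1 h1 h2
    obtain ⟨d1, d2, d3⟩ := hl₁.chain_downLocs hs.2 k1 k2
    obtain ⟨m1, m2, m3⟩ := hl.chain_upLocs hsl (.two (hl.isJudgement hsl)
      (by rw [c2, d2]; exact .resolve hres) c1 d1) rfl
    simp only [TraceTree.toProof, ← hj]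
    refine ⟨m1, m2, hsl.topLoc hl.1, m3.trans ?_⟩
    rw [ProofTree.nonFlow, c3, d3, h4, k4, TraceTree.numNodes]

theorem IsRootTrace.toProof_spec {ψ : QCBF} {T : TraceTree} (h : IsRootTrace ψ T) :
    IsTreeRefutation ψ T.toProof ∧ T.toProof.nonFlow = T.numNodes := by
  obtain ⟨h1, h2, -, h3⟩ := h.1.toProof_spec
  refine ⟨isTreeRefutation_iff.2 ⟨h1, ?_⟩, h3⟩
  rw [h2, h.2]
  simp [Label.clause, Label.init, varsOf]

/-! ### The translations on representations -/

namespace Datum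

/-- The representation of the child with number `k`. -/
def child (φ k : Datum) : Datum := cond (beq φ.hd (unary 1)) (drop φ.tl k).hd φ.tl.tl

/-- The representation of the subformula at a location. -/
def subformula (φ i : Datum) : Datum := listRec (fun c => c) (fun _ k _ r => child r k) φ (reverse i)

/-- The test whether a formula starts with a quantifier on `v`. -/
def quantifies (φ v : Datum) : Datum :=
  cond (beq φ.hd (unary 2)) (beq φ.tl.hd v) (cond (beq φ.hd (unary 3)) (beq φ.tl.hd v) nil)

/-- The location of the quantifier that binds `v` at the location `i`. -/
def binder (ψ i v : Datum) : Datum :=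
  (reverse (filter (fun c p => quantifies (subformula c.hd p) c.tl) (cons ψ v) (inits i))).hd

/-- The complements of the literals in a list. -/
def negate (l : Datum) : Datum := map (fun _ L => cons L.hd (not L.tl)) nil l

/-- The label that corresponds to a judgement. -/
def label (ψ J : Datum) : Datum :=
  cons (map (fun c L => cons (binder c.hd c.tl L.hd) L.hd) (cons ψ J.hd) J.tl) (negate J.tl)

/-- The root label of a tree of judgements. -/
def root (T : Datum) : Datum := cond T.hd T.tl.hd T.tl

/-- The positive literals in the first list whose complement is in the second list. -/
def clashes (α β : Datum) : Datum :=
  filter (fun c L => cond L.tl (mem (cons L.hd nil) c) nil) β α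

/-- The number of elements of a list, in unary. -/
def count (l : Datum) : Datum := map (fun _ _ => nil) nil l

/-- The trace of a leaf. -/
def traceLeaf (ψ T : Datum) : Datum := cons (unary 0) (cons (label ψ T.tl) T.tl.hd)

/-- The trace of a tree whose root has one child, from the trace of the child. -/
def traceOne (ψ T t : Datum) : Datum :=
  cond (beq (count T.tl.hd.tl) (count (root T.tl.tl).tl)) t
    (cons (unary 1) (cons (label ψ T.tl.hd) t))

/-- The trace of a tree whose root has two children, from the traces of the children. -/
def traceTwo (ψ T t₀ t₁ : Datum) : Datum :=
  cons (unary 2) (cons (label ψ T.tl.hd)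
    (cond (clashes (root T.tl.tl.hd).tl (root T.tl.tl.tl).tl) (cons t₀ t₁) (cons t₁ t₀)))

/-- The trace of a tree of judgements. -/
def toTrace (ψ T : Datum) : Datum := treeRec traceLeaf traceOne traceTwo ψ T

/-- The deepest location in a list of located variables. -/
def deepest (S : Datum) : Datum :=
  listRec (fun _ => nil) (fun _ x _ r => cond (lengthLE r x.hd) x.hd r) nil S

/-- The topmost location that follows a list of located variables. -/
def topLoc (S : Datum) : Datum := cond S (append (deepest S) (cons nil nil)) nil

/-- The proper prefixes of `i` from the length of `k` on. -/
def upLocs (i k : Datum) : Datum :=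
  filter (fun c p => cond (lengthLE c.tl p) (lengthLT p c.hd) nil) (cons i k) (inits i)

/-- The prefixes of `j` that are longer than `k`, the longest first. -/
def downLocs (k j : Datum) : Datum := reverse (filter lengthLT k (inits j))

/-- A chain of flow steps at the given locations, the last one first. -/
def chain (C T ls : Datum) : Datum :=
  listRec (fun c => c.tl) (fun c k _ r => cons (unary 1) (cons (cons k c.hd) r)) (cons C T) ls

/-- The longer one of two lists. -/
def longer (i j : Datum) : Datum := cond (lengthLE i j) j i

/-- The proof of a trace with one node. -/
def proofLeaf (_ T : Datum) : Datum :=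
  chain (negate T.tl.hd.tl) (cons (unary 0) (cons T.tl.tl (negate T.tl.hd.tl)))
    (upLocs T.tl.tl (topLoc T.tl.hd.hd))

/-- The proof of a trace whose root has one child, from the proof of the child. -/
def proofOne (_ T t : Datum) : Datum :=
  chain (negate T.tl.hd.tl)
    (cons (unary 1) (cons (cons (deepest T.tl.tl.tl.hd.hd) (negate T.tl.hd.tl)) t))
    (upLocs (deepest T.tl.tl.tl.hd.hd) (topLoc T.tl.hd.hd))

/-- The location of the resolution step for a trace whose root has two children. -/
def meetLoc (T : Datum) : Datum :=
  longer (topLoc T.tl.tl.hd.tl.hd.hd) (topLoc T.tl.tl.tl.tl.hd.hd)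

/-- The proof of a trace whose root has two children, from the proofs of the children. -/
def proofTwo (_ T t₀ t₁ : Datum) : Datum :=
  chain (negate T.tl.hd.tl)
    (cons (unary 2) (cons (cons (meetLoc T) (negate T.tl.hd.tl))
      (cons
        (chain (negate T.tl.tl.hd.tl.hd.tl) t₀
          (downLocs (topLoc T.tl.tl.hd.tl.hd.hd) (meetLoc T)))
        (chain (negate T.tl.tl.tl.tl.hd.tl) t₁
          (downLocs (topLoc T.tl.tl.tl.tl.hd.hd) (meetLoc T))))))
    (upLocs (meetLoc T) (topLoc T.tl.hd.hd))

/-- The tree of judgements of a trace. -/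
def toProof (T : Datum) : Datum := treeRec proofLeaf proofOne proofTwo nil T

/-! ### Size bounds for the operations on representations -/

theorem chain_cons (C T k ls : Datum) :
    chain C T (cons k ls) = cons (unary 1) (cons (cons k C) (chain C T ls)) := rfl

/-- The size of `T` enters additively, as the growth condition of `PolyTime.treeRec` demands. -/
theorem size_chain_le (C T ls : Datum) :
    (chain C T ls).size ≤ T.size + ls.size * (C.size + 7) := by
  induction ls with
  | nil => exact Nat.le_add_right _ _
  | cons k ls _ ih =>
    rw [chain_cons]
    simp only [size, unary, ofList, List.replicate] at *
    have := k.size_pos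
    nlinarith

theorem size_cond_le (c x y : Datum) : (cond c x y).size ≤ x.size + y.size := by
  cases c <;> simp [cond]

theorem size_child_le (φ k : Datum) : (child φ k).size ≤ φ.size := by
  have h1 := (drop φ.tl k).size_hd_le
  have h2 := size_drop_le φ.tl k
  have h3 := φ.size_tl_le
  have h4 := φ.tl.size_tl_le
  rw [child, cond_eq_ite]
  split_ifs <;> omega

theorem size_deepest_le (S : Datum) : (deepest S).size ≤ S.size := by
  induction S with
  | nil => exact le_rfl
  | cons x y _ ih =>
    change (cond (lengthLE (deepest y) x.hd) x.hd (deepest y)).size ≤ _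
    have := size_cond_le (lengthLE (deepest y) x.hd) x.hd (deepest y)
    have := x.size_hd_le
    simp only [size]
    omega

end Datum

/-! ### Polynomial time of the two translations -/

@[fun_prop]
theorem PolyTime.child {f g : Datum → Datum} (hf : PolyTime f) (hg : PolyTime g) :
    PolyTime fun x => Datum.child (f x) (g x) := by
  unfold Datum.child
  fun_prop

@[fun_prop]
theorem PolyTime.subformula {f g : Datum → Datum} (hf : PolyTime f) (hg : PolyTime g) :
    PolyTime fun x => Datum.subformula (f x) (g x) := by
  refine .listRec .id' (by fun_prop) ?_ hf hg.reverse
  refine PolyBounded.id.mono fun z => le_trans ?_ z.size_hd_le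
  induction z.tl with
  | nil => exact le_rfl
  | cons x y _ ih => exact (Datum.size_child_le _ _).trans ih

@[fun_prop]
theorem PolyTime.quantifies {f g : Datum → Datum} (hf : PolyTime f) (hg : PolyTime g) :
    PolyTime fun x => Datum.quantifies (f x) (g x) := by
  unfold Datum.quantifies
  fun_prop

@[fun_prop]
theorem PolyTime.binder {f g h : Datum → Datum} (hf : PolyTime f) (hg : PolyTime g)
    (hh : PolyTime h) : PolyTime fun x => Datum.binder (f x) (g x) (h x) :=
  (PolyTime.filter (by fun_prop) (by fun_prop) (by fun_prop)).reverse.hd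

@[fun_prop]
theorem PolyTime.negate {f : Datum → Datum} (hf : PolyTime f) :
    PolyTime fun x => Datum.negate (f x) :=
  .map (by fun_prop) (by fun_prop) hf

@[fun_prop]
theorem PolyTime.label {f g : Datum → Datum} (hf : PolyTime f) (hg : PolyTime g) :
    PolyTime fun x => Datum.label (f x) (g x) :=
  .cons (.map (by fun_prop) (by fun_prop) (by fun_prop)) (by fun_prop)

@[fun_prop]
theorem PolyTime.root {f : Datum → Datum} (hf : PolyTime f) :
    PolyTime fun x => Datum.root (f x) := by
  unfold Datum.root
  fun_prop

@[fun_prop]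
theorem PolyTime.clashes {f g : Datum → Datum} (hf : PolyTime f) (hg : PolyTime g) :
    PolyTime fun x => Datum.clashes (f x) (g x) :=
  .filter (by fun_prop) hg hf

@[fun_prop]
theorem PolyTime.count {f : Datum → Datum} (hf : PolyTime f) :
    PolyTime fun x => Datum.count (f x) :=
  .map (by fun_prop) (by fun_prop) hf

/-- A node adds at most a tag and one label, computed from the node alone, and uses each recursive
result once. -/
theorem PolyTime.toTrace {f g : Datum → Datum} (hf : PolyTime f) (hg : PolyTime g) :
    PolyTime fun x => Datum.toTrace (f x) (g x) := by
  obtain ⟨q, hq⟩ := PolyTime.size_bounded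
    (show PolyTime fun z => Datum.label z.hd z.tl.tl.hd by fun_prop)
  have hq' : ∀ c x, (Datum.label c x.tl.hd).size ≤ q.eval (Datum.cons c x).size :=
    fun c x => hq (.cons c x)
  refine .treeRec ?_ ?_ ?_ ⟨q + 5, fun c x r => ?_⟩ ⟨q + 8, fun c x r r' => ?_⟩ hf hg
  · unfold Datum.traceLeaf
    fun_prop
  · unfold Datum.traceOne
    fun_prop
  · unfold Datum.traceTwo
    fun_prop
  · have := hq' c x
    simp only [Datum.size] at this
    rw [Datum.traceOne, Datum.cond_eq_ite]
    split_ifs <;> simp [Datum.size, Datum.unary, Datum.ofList]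
    omega
  · have := hq' c x
    simp only [Datum.size] at this
    rw [Datum.traceTwo, Datum.cond_eq_ite]
    split_ifs <;> simp [Datum.size, Datum.unary, Datum.ofList] <;> omega

@[fun_prop]
theorem PolyTime.deepest {f : Datum → Datum} (hf : PolyTime f) :
    PolyTime fun x => Datum.deepest (f x) := by
  refine .listRec (.const _) (by fun_prop) ?_ (.const .nil) hf
  refine PolyBounded.id.mono fun z => le_trans ?_ z.size_tl_le
  have h : ∀ c l, QCBFTrace.listRec (fun _ => .nil)
      (fun _ x _ r => Datum.cond (Datum.lengthLE r x.hd) x.hd r) c l = Datum.deepest l := by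
    intro c l
    induction l with
    | nil => rfl
    | cons x y _ ih => rw [QCBFTrace.listRec, ih]; rfl
  rw [h]
  exact Datum.size_deepest_le _

@[fun_prop]
theorem PolyTime.topLoc {f : Datum → Datum} (hf : PolyTime f) :
    PolyTime fun x => Datum.topLoc (f x) := by
  unfold Datum.topLoc
  fun_prop

@[fun_prop]
theorem PolyTime.upLocs {f g : Datum → Datum} (hf : PolyTime f) (hg : PolyTime g) :
    PolyTime fun x => Datum.upLocs (f x) (g x) :=
  .filter (by fun_prop) (by fun_prop) (by fun_prop)

@[fun_prop]
theorem PolyTime.downLocs {f g : Datum → Datum} (hf : PolyTime f) (hg : PolyTime g) :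
    PolyTime fun x => Datum.downLocs (f x) (g x) :=
  (PolyTime.filter (by fun_prop) (by fun_prop) (by fun_prop)).reverse

@[fun_prop]
theorem PolyTime.chain {f g h : Datum → Datum} (hf : PolyTime f) (hg : PolyTime g)
    (hh : PolyTime h) : PolyTime fun x => Datum.chain (f x) (g x) (h x) := by
  refine .listRec (by fun_prop) (by fun_prop) ?_ (hf.cons hg) hh
  refine (PolyBounded.id.add (PolyBounded.id.mul (PolyBounded.id.add (.const 7)))).mono
    fun z => ?_
  have h1 := z.size_hd_le
  have h2 := z.size_tl_le
  have h3 := z.hd.size_hd_le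
  have h4 := z.hd.size_tl_le
  -- The recursion reads only the two components of its parameter, so an arbitrary datum acts like
  -- the pair of them.
  have h : ∀ c l, QCBFTrace.listRec (fun c => c.tl)
      (fun c k _ r => .cons (.unary 1) (.cons (.cons k c.hd) r)) c l =
        Datum.chain c.hd c.tl l := by
    intro c l
    induction l with
    | nil => rfl
    | cons x y _ ih => rw [QCBFTrace.listRec, ih]; rfl
  rw [h]
  exact (Datum.size_chain_le _ _ _).trans
    (Nat.add_le_add (by omega) (Nat.mul_le_mul h2 (by omega)))

@[fun_prop]
theorem PolyTime.longer {f g : Datum → Datum} (hf : PolyTime f) (hg : PolyTime g) :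
    PolyTime fun x => Datum.longer (f x) (g x) := by
  unfold Datum.longer
  fun_prop

@[fun_prop]
theorem PolyTime.meetLoc {f : Datum → Datum} (hf : PolyTime f) :
    PolyTime fun x => Datum.meetLoc (f x) := by
  unfold Datum.meetLoc
  fun_prop

/-- The chains added at a node depend only on its label and on the labels of its children in the
given trace, not on the recursive results, so the growth is additive. -/
theorem PolyTime.toProof {f : Datum → Datum} (hf : PolyTime f) :
    PolyTime fun x => Datum.toProof (f x) := by
  -- The growth condition measures `cons c x`, whose second component is the node `x`.
  have size {g : Datum → Datum} (hg : PolyTime g) : PolyBounded fun z => (g z.tl).size :=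
    PolyTime.size_bounded (f := fun z => g z.tl) (by fun_prop)
  have hC := size (g := fun x => Datum.negate x.tl.hd.tl) (by fun_prop)
  have hC₀ := size (g := fun x => Datum.negate x.tl.tl.hd.tl.hd.tl) (by fun_prop)
  have hC₁ := size (g := fun x => Datum.negate x.tl.tl.tl.tl.hd.tl) (by fun_prop)
  have hd := size (g := fun x => Datum.deepest x.tl.tl.tl.hd.hd) (by fun_prop)
  have hm := size (g := Datum.meetLoc) (by fun_prop)
  have hu₁ := size (g := fun x => Datum.upLocs (Datum.deepest x.tl.tl.tl.hd.hd)
    (Datum.topLoc x.tl.hd.hd)) (by fun_prop)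
  have hu₂ := size (g := fun x => Datum.upLocs (Datum.meetLoc x) (Datum.topLoc x.tl.hd.hd))
    (by fun_prop)
  have hd₀ := size (g := fun x => Datum.downLocs (Datum.topLoc x.tl.tl.hd.tl.hd.hd)
    (Datum.meetLoc x)) (by fun_prop)
  have hd₁ := size (g := fun x => Datum.downLocs (Datum.topLoc x.tl.tl.tl.tl.hd.hd)
    (Datum.meetLoc x)) (by fun_prop)
  obtain ⟨q₁, hq₁⟩ := ((hd.add hC).add (.const 6)).add (hu₁.mul (hC.add (.const 7)))
  obtain ⟨q₂, hq₂⟩ := ((((hm.add hC).add (.const 9)).add (hd₀.mul (hC₀.add (.const 7)))).add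
    (hd₁.mul (hC₁.add (.const 7)))).add (hu₂.mul (hC.add (.const 7)))
  refine .treeRec ?_ ?_ ?_ ⟨q₁, fun c x r => ?_⟩ ⟨q₂, fun c x r r' => ?_⟩ (.const _) hf
  · unfold Datum.proofLeaf
    fun_prop
  · unfold Datum.proofOne
    fun_prop
  · unfold Datum.proofTwo
    fun_prop
  · refine (Datum.size_chain_le _ _ _).trans ?_
    have := hq₁ (.cons c x)
    simp only [Datum.size, Datum.tl, Datum.unary, Datum.ofList, List.replicate] at *
    omega
  · refine (Datum.size_chain_le _ _ _).trans ?_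
    have := hq₂ (.cons c x)
    have := Datum.size_chain_le (Datum.negate x.tl.tl.hd.tl.hd.tl) r
      (Datum.downLocs (Datum.topLoc x.tl.tl.hd.tl.hd.hd) (Datum.meetLoc x))
    have := Datum.size_chain_le (Datum.negate x.tl.tl.tl.tl.hd.tl) r'
      (Datum.downLocs (Datum.topLoc x.tl.tl.tl.tl.hd.hd) (Datum.meetLoc x))
    simp only [Datum.size, Datum.tl, Datum.unary, Datum.ofList, List.replicate] at *
    omega

theorem PolyTime.polyTimeOn {α β : Type} {dom : α → Prop} {ra : α → Datum → Prop}
    {rb : β → Datum → Prop} {F : α → β} {f : Datum → Datum} (hf : PolyTime f)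
    (h : ∀ x, dom x → ∀ d, ra x d → rb (F x) (f d)) : PolyTimeOn dom ra rb F := by
  obtain ⟨e, p, he⟩ := hf
  refine ⟨e, p, fun x hx d hd => ?_⟩
  obtain ⟨t, ht, htp⟩ := he e d
  exact ⟨f d, t, ht, htp, h x hx d hd⟩

/-! ### Correctness of the translations on representations -/

theorem Datum.ofList_map_injective {α : Type} {enc : α → Datum} (h : Function.Injective enc) :
    Function.Injective fun l : List α => Datum.ofList (l.map enc) :=
  Datum.ofList_injective.comp (List.map_injective_iff.2 h)

theorem Datum.unary_injective : Function.Injective Datum.unary := by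
  intro k l h
  simpa using congrArg List.length (Datum.ofList_injective h)

theorem Datum.binary_injective : Function.Injective Datum.binary := by
  -- Folding with `Nat.bit` recovers a number from its bits.
  have hbits : Function.LeftInverse (fun l => l.foldr Nat.bit 0) Nat.bits := by
    intro n
    induction n using Nat.binaryRec' with
    | zero => simp
    | bit b n h ih => rw [Nat.bits_append_bit n b h]; exact congrArg (Nat.bit b) ih
  exact (Datum.ofList_map_injective Datum.ofBool_injective).comp hbits.injective

theorem Datum.ofLiteral_injective : Function.Injective Datum.ofLiteral := by
  rintro ⟨v, b⟩ ⟨v', b'⟩ h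
  simp only [Datum.ofLiteral, Datum.cons.injEq] at h
  rw [Datum.binary_injective h.1, Datum.ofBool_injective h.2]

theorem Datum.inits_ofLoc (i : Loc) : Datum.inits (.ofLoc i) = .ofList (i.inits.map .ofLoc) := by
  have h : (i.map Datum.unary).inits = i.inits.map (List.map Datum.unary) := by
    induction i with
    | nil => rfl
    | cons a i ih => simp [ih, Function.comp_def]
  rw [Datum.ofLoc, Datum.inits_ofList, h, List.map_map]
  rfl

theorem Datum.lengthLE_ofLoc (i j : Loc) :
    Datum.lengthLE (.ofLoc i) (.ofLoc j) ≠ .nil ↔ i.length ≤ j.length := by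
  rw [Datum.ofLoc, Datum.ofLoc, Datum.lengthLE_ofList, List.length_map, List.length_map]

theorem Datum.lengthLT_ofLoc (i j : Loc) :
    Datum.lengthLT (.ofLoc i) (.ofLoc j) ≠ .nil ↔ i.length < j.length := by
  rw [Datum.ofLoc, Datum.ofLoc, Datum.lengthLT_ofList, List.length_map, List.length_map]

theorem Datum.hd_ofList (l : List Datum) : (Datum.ofList l).hd = l.headD .nil := by
  cases l <;> rfl

theorem Datum.hd_ofList_map_ofLoc (l : List Loc) :
    (Datum.ofList (l.map .ofLoc)).hd = .ofLoc (l.headD []) := by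
  cases l <;> rfl

theorem Datum.hd_cons (x y : Datum) : (Datum.cons x y).hd = x := rfl

theorem Datum.tl_cons (x y : Datum) : (Datum.cons x y).tl = y := rfl

/-- Injectivity on `s` keeps the listing free of repetitions. It cannot be asked globally: passing
from literals to variables is injective only within a clause. -/
theorem RepSet.map {α β : Type} {enc : α → Datum} {enc' : β → Datum} {s : Set α} {d : Datum}
    (h : RepSet enc s d) {g : Datum → Datum → Datum} {c : Datum} (f : α → β) (hf : s.InjOn f)
    (hg : ∀ x ∈ s, g c (enc x) = enc' (f x)) : RepSet enc' (f '' s) (Datum.map g c d) := by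
  obtain ⟨l, hl, hs, rfl⟩ := h
  refine ⟨l.map f, hl.map_on fun x hx y hy => hf ((hs x).1 hx) ((hs y).1 hy), fun y => ?_, ?_⟩
  · simp [hs]
  · rw [Datum.map_ofList, List.map_map, List.map_map]
    congr 1
    exact List.map_congr_left fun x hx => hg x ((hs x).1 hx)

/-! #### Formulas -/

theorem Datum.beq_unary {a b : ℕ} : Datum.beq (.unary a) (.unary b) = .ofBool (decide (a = b)) := by
  simp [Datum.beq, Datum.unary_injective.eq_iff]

theorem RepFormula.child {θ φ : QCBF} {d : Datum} (h : RepFormula θ d) {k : ℕ}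
    (hk : θ.at? [k] = some φ) : RepFormula φ (Datum.child d (.unary k)) := by
  cases h with
  | clause h => simp [QCBF.at?] at hk
  | @conj n χ d h =>
    simp only [QCBF.at?, QCBF.at?_nil] at hk
    split_ifs at hk with hkn
    rw [Option.some.injEq] at hk
    subst hk
    have : Datum.child (.cons (.unary 1) (.ofList (List.ofFn d))) (.unary k) = d ⟨k, hkn⟩ := by
      simp only [Datum.child, Datum.hd_cons, Datum.tl_cons, Datum.beq_unary, Datum.cond_ofBool,
        decide_true, if_true]
      rw [Datum.unary, Datum.drop_ofList, Datum.hd_ofList, List.headD_eq_head?_getD,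
        List.head?_drop]
      simp [hkn]
    rw [this]
    exact h _
  | all h =>
    simp only [QCBF.at?, QCBF.at?_nil] at hk
    split_ifs at hk
    rw [Option.some.injEq] at hk
    subst hk
    exact h
  | ex h =>
    simp only [QCBF.at?, QCBF.at?_nil] at hk
    split_ifs at hk
    rw [Option.some.injEq] at hk
    subst hk
    exact h

/-- `listRec` treats the head last, so on the reversed path its outermost step is the last step of
the path. -/
theorem Datum.subformula_concat (d : Datum) (i : Loc) (a : ℕ) :
    Datum.subformula d (.ofLoc (i ++ [a])) =
      Datum.child (Datum.subformula d (.ofLoc i)) (.unary a) := by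
  simp only [Datum.subformula, Datum.ofLoc, Datum.reverse_ofList, List.map_append,
    List.reverse_append]
  rfl

theorem RepFormula.subformula {ψ φ : QCBF} {d : Datum} (h : RepFormula ψ d) {i : Loc}
    (hi : ψ.at? i = some φ) : RepFormula φ (Datum.subformula d (.ofLoc i)) := by
  induction i using List.reverseRecOn generalizing φ with
  | nil =>
    rw [QCBF.at?_nil, Option.some.injEq] at hi
    exact hi ▸ h
  | append_singleton i a ih =>
    rw [QCBF.at?_append, Option.bind_eq_some_iff] at hi
    obtain ⟨θ, h1, h2⟩ := hi
    rw [Datum.subformula_concat]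
    exact (ih h1).child h2

theorem RepFormula.quantifies_iff {θ : QCBF} {d : Datum} (h : RepFormula θ d) (v : Var) :
    Datum.quantifies d (.binary v) ≠ .nil ↔ (∃ φ, θ = .all v φ) ∨ ∃ φ, θ = .ex v φ := by
  cases h <;>
    simp [Datum.quantifies, Datum.hd_cons, Datum.tl_cons, Datum.beq_unary, Datum.cond_ofBool,
      Datum.beq_eq_nil, Datum.binary_injective.eq_iff]

theorem RepFormula.binder {ψ : QCBF} {d : Datum} (h : RepFormula ψ d) {i : Loc}
    (hi : ∃ φ, ψ.at? i = some φ) (v : Var) :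
    Datum.binder d (.ofLoc i) (.binary v) = .ofLoc (binder ψ i v) := by
  classical
  rw [Datum.binder, Datum.inits_ofLoc, Datum.filter_map_ofList Datum.ofLoc _ _
    (fun p => decide (IsLocated ψ (p, v))), Datum.reverse_ofList, ← List.map_reverse,
    Datum.hd_ofList_map_ofLoc]
  · rfl
  · intro p hp
    obtain ⟨φ, hφ⟩ := QCBF.exists_at?_of_prefix ((List.mem_inits _ _).1 hp) hi
    refine ((h.subformula hφ).quantifies_iff v).trans ?_
    simp [IsLocated, IsAllLocated, hφ]

/-! #### Labels -/

/-- Serves both directions: complementing turns the literals of a clause into the graph of its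
falsifying assignment and back. -/
theorem RepSet.negate {s t : Set Literal} {d : Datum} (h : RepSet Datum.ofLiteral s d)
    (ht : ∀ v b, (v, b) ∈ t ↔ (v, !b) ∈ s) : RepSet Datum.ofLiteral t (Datum.negate d) := by
  have := h.map (enc' := Datum.ofLiteral) (g := fun _ L => .cons L.hd (.not L.tl)) (c := .nil)
    Literal.compl (fun L _ L' _ h => by simpa [Literal.compl, Prod.ext_iff] using h)
    (fun L _ => by simp [Datum.ofLiteral, Literal.compl, Datum.hd_cons, Datum.tl_cons, Datum.not_ofBool])
  suffices hst : t = Literal.compl '' s by rw [hst]; exact this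
  ext ⟨v, b⟩
  rw [ht]
  constructor
  · intro h
    exact ⟨_, h, by simp [Literal.compl]⟩
  · rintro ⟨⟨v', b'⟩, h, h'⟩
    simp only [Literal.compl, Prod.mk.injEq] at h'
    obtain ⟨rfl, rfl⟩ := h'
    simpa using h

theorem RepJudgement.label {ψ : QCBF} {d : Datum} (hψ : RepFormula ψ d) {J : Judgement}
    {c : Datum} (hJ : RepJudgement J c) (hJψ : IsJudgement ψ J) :
    RepLabel (J.label ψ) (Datum.label d c) := by
  obtain ⟨c, hc, rfl⟩ := hJ
  have hi : ∃ φ, ψ.at? J.loc = some φ := ⟨_, hJψ.choose_spec.1⟩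
  refine ⟨_, _, ?_, ?_, rfl⟩
  · have := hc.map (enc' := Datum.ofLocVar)
      (g := fun c L => .cons (Datum.binder c.hd c.tl L.hd) L.hd) (c := .cons d (.ofLoc J.loc))
      (fun L : Literal => (binder ψ J.loc L.1, L.1)) ?_ ?_
    · refine Eq.mp (congrArg (RepSet _ · _) ?_) this
      ext x
      simp [Judgement.label, Clause.vars]
    -- A clause has only one literal on each variable, so no located variable is listed twice.
    · rintro ⟨v, b⟩ hb ⟨v', b'⟩ hb' h
      obtain rfl : v = v' := congrArg Prod.snd h
      have := J.clause.nontaut v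
      cases b <;> cases b' <;> simp_all
    · intro L _
      simp only [Datum.hd_cons, Datum.tl_cons, Datum.ofLiteral, Datum.ofLocVar, hψ.binder hi]
  · exact hc.negate fun v b => Clause.falsifier_eq_some

theorem RepProofTree.root {T : ProofTree} {d : Datum} (h : RepProofTree T d) :
    RepJudgement T.root (Datum.root d) := by
  cases h <;> assumption

/-- The result is the same for all listings of the clause, so comparing counts is comparing
cardinalities. -/
theorem RepClause.count {C : Clause} {c : Datum} (h : RepClause C c) :
    Datum.count c = .unary C.lits.card := by
  obtain ⟨l, hl, hs, rfl⟩ := h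
  have : l.toFinset = C.lits := by
    ext L
    rw [List.mem_toFinset, hs, Finset.mem_coe]
  rw [← this, List.toFinset_card_of_nodup hl, Datum.count, Datum.map_ofList, List.map_map,
    Datum.unary]
  congr 1
  exact List.map_const' (l := l) (b := Datum.nil)

theorem RepClause.mem_iff {C : Clause} {c : Datum} (h : RepClause C c) (L : Literal) :
    Datum.mem (.ofLiteral L) c ≠ .nil ↔ L ∈ C.lits := by
  obtain ⟨l, -, hs, rfl⟩ := h
  rw [Datum.mem_ofList, List.mem_map_of_injective Datum.ofLiteral_injective, hs, Finset.mem_coe]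

theorem RepClause.clashes_iff {α β : Clause} {c c' : Datum} (h : RepClause α c)
    (h' : RepClause β c') :
    Datum.clashes c c' ≠ .nil ↔ ∃ v, (v, true) ∈ α.lits ∧ (v, false) ∈ β.lits := by
  classical
  obtain ⟨l, -, hs, rfl⟩ := h
  rw [Datum.clashes, Datum.filter_map_ofList Datum.ofLiteral _ _
    (fun L : Literal => L.2 && decide ((L.1, false) ∈ β.lits)), Ne, Datum.ofList_eq_nil,
    List.map_eq_nil_iff, List.filter_eq_nil_iff]
  · push Not
    constructor
    · rintro ⟨⟨v, b⟩, h1, h2⟩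
      simp only [Bool.and_eq_true, decide_eq_true_eq] at h2
      obtain ⟨rfl, h2⟩ := h2
      exact ⟨v, (hs _).1 h1, h2⟩
    · rintro ⟨v, h1, h2⟩
      exact ⟨(v, true), (hs _).2 h1, by simp [h2]⟩
  · rintro ⟨v, b⟩ -
    have := h'.mem_iff (v, false)
    cases b
    · simp [Datum.ofLiteral, Datum.tl_cons, Datum.ofBool, Datum.cond]
    · simpa [Datum.ofLiteral, Datum.tl_cons, Datum.hd_cons, Datum.ofBool, Datum.cond] using this

/-! #### Traces of proofs -/

theorem treeRec_leaf {h₀ : Datum → Datum → Datum} {h₁ : Datum → Datum → Datum → Datum}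
    {h₂ : Datum → Datum → Datum → Datum → Datum} (c d : Datum) :
    treeRec h₀ h₁ h₂ c (.cons (.unary 0) d) = h₀ c (.cons (.unary 0) d) := by
  rw [treeRec]; exact dif_pos rfl

theorem treeRec_one {h₀ : Datum → Datum → Datum} {h₁ : Datum → Datum → Datum → Datum}
    {h₂ : Datum → Datum → Datum → Datum → Datum} (c l d : Datum) :
    treeRec h₀ h₁ h₂ c (.cons (.unary 1) (.cons l d)) =
      h₁ c (.cons (.unary 1) (.cons l d)) (treeRec h₀ h₁ h₂ c d) := by
  rw [treeRec, dif_neg (by simp [Datum.hd_cons, Datum.unary, Datum.ofList])]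
  exact if_pos rfl

theorem treeRec_two {h₀ : Datum → Datum → Datum} {h₁ : Datum → Datum → Datum → Datum}
    {h₂ : Datum → Datum → Datum → Datum → Datum} (c l d₀ d₁ : Datum) :
    treeRec h₀ h₁ h₂ c (.cons (.unary 2) (.cons l (.cons d₀ d₁))) =
      h₂ c (.cons (.unary 2) (.cons l (.cons d₀ d₁)))
        (treeRec h₀ h₁ h₂ c d₀) (treeRec h₀ h₁ h₂ c d₁) := by
  rw [treeRec, dif_neg (by simp [Datum.hd_cons, Datum.unary, Datum.ofList]),
    if_neg (by simp [Datum.hd, Datum.tl, Datum.unary, Datum.ofList, List.replicate])]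
  rfl

theorem RepJudgement.clause {J : Judgement} {c : Datum} (h : RepJudgement J c) :
    RepClause J.clause c.tl := by
  obtain ⟨c, hc, rfl⟩ := h
  exact hc

theorem RepJudgement.mk {C : Clause} {c : Datum} (h : RepClause C c) (i : Loc) :
    RepJudgement ⟨i, C⟩ (.cons (.ofLoc i) c) :=
  ⟨c, h, rfl⟩

theorem RepJudgement.loc {J : Judgement} {c : Datum} (h : RepJudgement J c) :
    c.hd = .ofLoc J.loc := by
  obtain ⟨c, -, rfl⟩ := h
  rfl

/-- Validity of the tree guarantees that locations exist, without which the computed binders would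
be meaningless, and hence that labels are represented correctly. -/
theorem RepProofTree.toTrace {ψ : QCBF} {e : Datum} (hψ : RepFormula ψ e) {T : ProofTree}
    {d : Datum} (h : RepProofTree T d) (hT : ValidTree ψ T) :
    RepTraceTree (T.toTrace ψ) (Datum.toTrace e d) := by
  induction h with
  | leaf hJ =>
    cases hT with
    | leaf hJψ _ =>
      rw [Datum.toTrace, treeRec_leaf, Datum.traceLeaf, ProofTree.toTrace]
      simp only [Datum.tl_cons, hJ.loc]
      exact .leaf (hJ.label hψ hJψ)
  | @one J T c d hJ hT' ih =>
    cases hT with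
    | one hJψ _ hT =>
      have ih := ih hT
      rw [Datum.toTrace] at ih
      rw [Datum.toTrace, treeRec_one, Datum.traceOne, ProofTree.toTrace]
      simp only [Datum.tl_cons, Datum.hd_cons, hJ.clause.count, hT'.root.clause.count, Datum.beq_unary,
        Datum.cond_ofBool, decide_eq_true_eq]
      split_ifs
      · exact ih
      · exact .one (hJ.label hψ hJψ) ih
  | @two J T₀ T₁ c d₀ d₁ hJ h₀ h₁ ih₀ ih₁ =>
    cases hT with
    | two hJψ _ hT₀ hT₁ =>
      have ih₀ := ih₀ hT₀
      have ih₁ := ih₁ hT₁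
      rw [Datum.toTrace] at ih₀ ih₁
      rw [Datum.toTrace, treeRec_two, Datum.traceTwo, ProofTree.toTrace]
      simp only [Datum.tl_cons, Datum.hd_cons, Datum.cond_eq_ite]
      have hiff := h₀.root.clause.clashes_iff h₁.root.clause
      by_cases hc : ∃ v, (v, true) ∈ T₀.root.clause.lits ∧ (v, false) ∈ T₁.root.clause.lits
      · rw [if_pos hc, if_neg (hiff.2 hc)]
        exact .two (hJ.label hψ hJψ) ih₀ ih₁
      · rw [if_neg hc, if_pos (not_not.1 (mt hiff.1 hc))]
        exact .two (hJ.label hψ hJψ) ih₁ ih₀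

/-! #### Proofs of traces -/

/-- For an arbitrary list the result may depend on the order, so only its maximality is recorded;
coherence makes it unique in `RepSet.deepest`. -/
theorem Datum.exists_deepest_eq (l : List LocVar) :
    ∃ k : Loc, Datum.deepest (.ofList (l.map .ofLocVar)) = .ofLoc k ∧
      (∀ y ∈ l, y.1.length ≤ k.length) ∧ (l = [] → k = []) ∧ (l ≠ [] → ∃ x ∈ l, x.1 = k) := by
  induction l with
  | nil => exact ⟨[], rfl, by simp, fun _ => rfl, by simp⟩
  | cons x l ih =>
    obtain ⟨k, h1, h2, h3, h4⟩ := ih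
    have heq : Datum.deepest (.ofList ((x :: l).map .ofLocVar)) =
        .ofLoc (if k.length ≤ x.1.length then x.1 else k) := by
      change Datum.cond (Datum.lengthLE (Datum.deepest (.ofList (l.map .ofLocVar))) (.ofLoc x.1))
        (.ofLoc x.1) (Datum.deepest (.ofList (l.map .ofLocVar))) = _
      rw [h1, Datum.cond_eq_ite, apply_ite Datum.ofLoc]
      have := Datum.lengthLE_ofLoc k x.1
      by_cases h : k.length ≤ x.1.length
      · rw [if_neg (this.2 h), if_pos h]
      · rw [if_pos (not_not.1 (mt this.1 h)), if_neg h]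
    refine ⟨_, heq, ?_, by simp, fun _ => ?_⟩
    · intro y hy
      rcases List.mem_cons.1 hy with rfl | hy
      · split_ifs <;> omega
      · have := h2 y hy
        split_ifs <;> omega
    · split_ifs with h
      · exact ⟨x, by simp, rfl⟩
      · have hne : l ≠ [] := fun hl => h (by simp [h3 hl])
        obtain ⟨y, hy, hyk⟩ := h4 hne
        exact ⟨y, by simp [hy], hyk⟩

theorem RepSet.deepest {ψ : QCBF} {S : Finset LocVar} (hS : IsCoherent ψ S) {s : Datum}
    (h : RepSet Datum.ofLocVar (S : Set LocVar) s) : Datum.deepest s = .ofLoc (deepest S) := by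
  obtain ⟨l, -, hs, rfl⟩ := h
  obtain ⟨k, h1, h2, h3, h4⟩ := Datum.exists_deepest_eq l
  rw [h1]
  congr 1
  by_cases hl : l = []
  · have : S = ∅ := by
      ext x
      simpa [hl] using (hs x).symm
    rw [h3 hl, this]
    simp [QCBFTrace.deepest]
  · obtain ⟨x, hx, rfl⟩ := h4 hl
    exact (hS.deepest_eq ((hs x).1 hx) fun y hy => h2 y ((hs y).2 hy)).symm

theorem RepSet.topLoc {ψ : QCBF} {S : Finset LocVar} (hS : IsCoherent ψ S) {s : Datum}
    (h : RepSet Datum.ofLocVar (S : Set LocVar) s) : Datum.topLoc s = .ofLoc (topLoc S) := by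
  rw [Datum.topLoc, h.deepest hS]
  obtain ⟨l, -, hs, rfl⟩ := h
  have hnil : Datum.ofList (l.map .ofLocVar) = .nil ↔ l = [] := by
    rw [Datum.ofList_eq_nil, List.map_eq_nil_iff]
  rw [Datum.cond_eq_ite]
  rcases S.eq_empty_or_nonempty with rfl | ⟨x, hx⟩
  · have : l = [] := List.eq_nil_iff_forall_not_mem.2 fun x hx => by simpa using (hs x).1 hx
    rw [if_pos (hnil.2 this), topLoc_empty]
    rfl
  · have : l ≠ [] := List.ne_nil_of_mem ((hs x).2 hx)
    rw [if_neg (mt hnil.1 this), topLoc_of_nonempty ⟨x, hx⟩, Datum.ofLoc, Datum.ofLoc, List.map_append]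
    exact Datum.append_ofList _ [.nil]

theorem Datum.upLocs_ofLoc (i k : Loc) :
    Datum.upLocs (.ofLoc i) (.ofLoc k) = .ofList ((QCBFTrace.upLocs i k).map .ofLoc) := by
  rw [Datum.upLocs, Datum.inits_ofLoc]
  refine Datum.filter_map_ofList _ _ _ _ _ fun p _ => ?_
  have h1 := Datum.lengthLE_ofLoc k p
  have h2 := Datum.lengthLT_ofLoc p i
  simp only [Datum.hd_cons, Datum.tl_cons, Datum.cond_eq_ite, Bool.and_eq_true, decide_eq_true_eq,
    ← h1, ← h2]
  split_ifs with h <;> simp [h]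

theorem Datum.downLocs_ofLoc (k j : Loc) :
    Datum.downLocs (.ofLoc k) (.ofLoc j) = .ofList ((QCBFTrace.downLocs k j).map .ofLoc) := by
  rw [Datum.downLocs, Datum.inits_ofLoc, Datum.filter_map_ofList _ _ _
    (fun p => decide (k.length < p.length)), Datum.reverse_ofList, ← List.map_reverse]
  · rfl
  · intro p _
    simp only [Datum.lengthLT_ofLoc, decide_eq_true_eq]

theorem Datum.longer_ofLoc (i j : Loc) :
    Datum.longer (.ofLoc i) (.ofLoc j) = .ofLoc (QCBFTrace.longer i j) := by
  have := Datum.lengthLE_ofLoc i j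
  rw [Datum.longer, QCBFTrace.longer, Datum.cond_eq_ite]
  by_cases h : i.length ≤ j.length
  · rw [if_neg (this.2 h), if_pos h]
  · rw [if_pos (not_not.1 (mt this.1 h)), if_neg h]

theorem RepProofTree.chain {C : Clause} {c : Datum} (hC : RepClause C c) {T : ProofTree}
    {d : Datum} (hT : RepProofTree T d) (ls : List Loc) :
    RepProofTree (.chain C T ls) (Datum.chain c d (.ofList (ls.map .ofLoc))) := by
  induction ls with
  | nil => exact hT
  | cons k ls ih => exact .one (.mk hC k) ih

theorem RepLabel.clause {ψ : QCBF} {l : Label} (hl : IsLabel ψ l) {c : Datum}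
    (h : RepLabel l c) : RepClause l.clause (Datum.negate c.tl) := by
  obtain ⟨s, a, -, ha, rfl⟩ := h
  exact RepSet.negate ha fun v b => hl.mem_clause

theorem RepLabel.deepest {ψ : QCBF} {l : Label} (hl : IsLabel ψ l) {c : Datum}
    (h : RepLabel l c) : Datum.deepest c.hd = .ofLoc (deepest l.S) := by
  obtain ⟨s, a, hs, -, rfl⟩ := h
  exact hs.deepest hl.1

theorem RepLabel.topLoc {ψ : QCBF} {l : Label} (hl : IsLabel ψ l) {c : Datum}
    (h : RepLabel l c) : Datum.topLoc c.hd = .ofLoc (topLoc l.S) := by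
  obtain ⟨s, a, hs, -, rfl⟩ := h
  exact hs.topLoc hl.1

theorem RepTraceTree.root {T : TraceTree} {d : Datum} (h : RepTraceTree T d) :
    RepLabel T.root d.tl.hd := by
  cases h <;> assumption

/-- That the tree is a trace supplies coherent label sets, for which the computed deepest locations
agree with the chosen ones whatever the listing. -/
theorem RepTraceTree.toProof {ψ : QCBF} {T : TraceTree} {d : Datum} (h : RepTraceTree T d)
    (hT : IsTrace ψ T) : RepProofTree T.toProof (Datum.toProof d) := by
  induction h with
  | @leaf l i c hl =>
    cases hT with
    | leaf hlψ _ =>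
      rw [Datum.toProof, treeRec_leaf, Datum.proofLeaf, TraceTree.toProof]
      simp only [Datum.tl_cons, Datum.hd_cons, hl.topLoc hlψ, Datum.upLocs_ofLoc]
      exact .chain (hl.clause hlψ) (.leaf (.mk (hl.clause hlψ) _)) _
  | @one l T c d hl hT' ih =>
    cases hT with
    | one hlψ _ hT =>
      have ih := ih hT
      rw [Datum.toProof] at ih
      rw [Datum.toProof, treeRec_one, Datum.proofOne, TraceTree.toProof]
      simp only [Datum.tl_cons, Datum.hd_cons, hl.topLoc hlψ, hT'.root.deepest hT.isLabel,
        Datum.upLocs_ofLoc]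
      exact .chain (hl.clause hlψ) (.one (.mk (hl.clause hlψ) _) ih) _
  | @two l T₀ T₁ c d₀ d₁ hl h₀ h₁ ih₀ ih₁ =>
    cases hT with
    | two hlψ _ hT₀ hT₁ =>
      have ih₀ := ih₀ hT₀
      have ih₁ := ih₁ hT₁
      rw [Datum.toProof] at ih₀ ih₁
      rw [Datum.toProof, treeRec_two, Datum.proofTwo, TraceTree.toProof]
      simp only [Datum.meetLoc, Datum.tl_cons, Datum.hd_cons, hl.topLoc hlψ, h₀.root.topLoc hT₀.isLabel,
        h₁.root.topLoc hT₁.isLabel, Datum.longer_ofLoc, Datum.upLocs_ofLoc, Datum.downLocs_ofLoc]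
      exact .chain (hl.clause hlψ) (.two (.mk (hl.clause hlψ) _)
        (.chain (h₀.root.clause hT₀.isLabel) ih₀ _)
        (.chain (h₁.root.clause hT₁.isLabel) ih₁ _)) _

end QCBFTrace

theorem mainTheorem5 :
    (∀ ψ : QCBF, ψ.IsInstance → ∀ n : ℕ, 1 ≤ n →
      ((∃ P : ProofTree, IsTreeRefutation ψ P ∧ P.nonFlow = n) ↔
        ∃ T : TraceTree, IsRootTrace ψ T ∧ T.numNodes = n)) ∧
    (∃ F : QCBF × ProofTree → TraceTree,
      PolyTimeOn (fun x => x.1.IsInstance ∧ IsTreeRefutation x.1 x.2)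
        (RepPair RepFormula RepProofTree) RepTraceTree F ∧
      ∀ ψ : QCBF, ψ.IsInstance → ∀ P : ProofTree, IsTreeRefutation ψ P →
        IsRootTrace ψ (F (ψ, P)) ∧ (F (ψ, P)).numNodes = P.nonFlow) ∧
    (∃ G : QCBF × TraceTree → ProofTree,
      PolyTimeOn (fun x => x.1.IsInstance ∧ IsRootTrace x.1 x.2)
        (RepPair RepFormula RepTraceTree) RepProofTree G ∧
      ∀ ψ : QCBF, ψ.IsInstance → ∀ T : TraceTree, IsRootTrace ψ T →
        IsTreeRefutation ψ (G (ψ, T)) ∧ (G (ψ, T)).nonFlow = T.numNodes) := by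
  refine ⟨fun ψ hψ n _ => ⟨?_, ?_⟩, ⟨fun x => x.2.toTrace x.1, ?_, ?_⟩,
    ⟨fun x => x.2.toProof, ?_, ?_⟩⟩
  · rintro ⟨P, hP, rfl⟩
    exact ⟨_, hP.toTrace_spec hψ⟩
  · rintro ⟨T, hT, rfl⟩
    exact ⟨_, hT.toProof_spec⟩
  · refine (PolyTime.toTrace (PolyTime.id'.hd) (PolyTime.id'.tl)).polyTimeOn ?_
    rintro ⟨ψ, P⟩ ⟨-, hP⟩ _ ⟨e, d, he, hd, rfl⟩
    exact RepProofTree.toTrace he hd (isTreeRefutation_iff.1 hP).1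
  · exact fun ψ hψ P hP => hP.toTrace_spec hψ
  · refine (PolyTime.toProof (PolyTime.id'.tl)).polyTimeOn ?_
    rintro ⟨ψ, T⟩ ⟨-, hT⟩ _ ⟨e, d, he, hd, rfl⟩
    exact RepTraceTree.toProof hd hT.1
  · exact fun ψ hψ T hT => hT.toProof_spec
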